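/- **Theorem.** Consider a body with mass distribution $\mu$ that moves freely and changes its shape during the five stages $[t_{i-1},t_i]$, $i=1,\dots,5$, of a dive, $t_0=0$; write $\tau_i=t_i-t_{i-1}$, with $\tau_1,\tau_3,\tau_5\ge 0$ and $\tau_2,\tau_4>0$. Let $Q(t)$ denote the position of a material point in the body frame (origin at the centre of mass), $R(t)\in SO(3)$ the orientation, continuously differentiable on each closed stage, $I(t)=\int(|Q|^2\mathbb 1-QQ^{t})\,d\mu$ the tensor of inertia (assumed invertible), and $\Omega$ the angular velocity in the body frame, $\Omega\times v=R^t\dot R v$. Assume that the angular momentum $\mathbf l=\int RQ\times\frac{d}{dt}(RQ)\,d\mu$ in the space-fixed frame is a constant non-zero vector of length $l$, and put $L=R^t\mathbf l$. Assume further: * in stages 1, 3 and 5 the shape is constant, with tensors of inertia $I_s$, $I_t$, $I_s$ respectively; in stages 2 and 4 it changes arbitrarily (the shape being continuous throughout); * stages 1 and 5 are pure somersault: $L\equiv(0,l,0)$ there; * the solution $\gamma$ of the rigid-body Euler equations $\dot\gamma=\gamma\times I_t^{-1}\gamma$ with $\gamma(0)=L(t_2)$ is periodic with least period $T_t>0$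 (so $L(t_2+s)=\gamma(s)$ during stage 3). Let $E_s=\frac12 L_s\cdot I_s^{-1}L_s$ with $L_s=(0,l,0)$, $E_t=\frac12L(t_2)\cdot I_t^{-1}L(t_2)$, and $$\bar E_i=\frac1{2\tau_i}\int_{t_{i-1}}^{t_i}L\cdot\Omega\,dt,\qquad i=2,4 .$$ Let $S$ be the solid angle of a $C^2$-parametrised band on the sphere $|L|=l$ between the orbit $\gamma$ and the equator $L_z=0$, oriented so that $\gamma$, traversed once in its own direction, is part of its positively oriented boundary. For a natural number $n$ (the number of twists), let $S_-$ be the solid angle of a $C^2$-parametrised triangle on this sphere whose positively oriented boundary consists of stage 4 run backwards (from $L_s$ to $L(t_3)$), the part of the orbit $\gamma$ from parameter $\tau_3$ to parameter $nT_t$ (from $L(t_3)$ to $L(t_2)$), and stage 2 run backwards (from $L(t_2)$ to $L_s$). Here solid angles are $\iint r\cdot dA/|r|^3$, counted with sign (outward orientation positive), and neither the band nor the triangle contains the poles $(0,0,\pm l)$. Put $$\Delta\phi_{kick}=(\tau_1+\tau_5)\frac{2E_s}{l}+\tau_3\frac{2E_t}{l}-nS .$$ Then the angle of rotation $\phi$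 about the fixed axis $\mathbf l$, that is, a continuous azimuth about $\mathbf l$ of the head-to-toe axis $R(t)e_z$, exists on $[t_0,t_5]$, and for every choice of it the total change $\Delta\phi=\phi(t_5)-\phi(t_0)$ (a real number, not just modulo $2\pi$) satisfies: $R(t_5)$ is $R(t_0)$ followed by the rotation by $\Delta\phi$ about $\mathbf l$, and $$\Delta\phi=\Delta\phi_{kick}+\frac{2\bar E_2\tau_2}{l}+\frac{2\bar E_4\tau_4}{l}+S_- .$$ -/

import Mathlib

open Set MeasureTheory
open scoped Matrix

noncomputable section

namespace Somersault

/-! ### Shape-changing bodies -/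

/-- Tensor of inertia `∫ (|Q|² 1 - Q Qᵗ) dμ` of a body with mass distribution `μ`, whose material
point with label `b` sits at `Q b` (in the body frame, origin at the centre of mass). -/
def inertia {B : Type*} [MeasurableSpace B] (μ : Measure B) (Q : B → Fin 3 → ℝ) :
    Matrix (Fin 3) (Fin 3) ℝ :=
  Matrix.of fun i j =>
    ∫ b, ((Q b ⬝ᵥ Q b) • (1 : Matrix (Fin 3) (Fin 3) ℝ) - Matrix.vecMulVec (Q b) (Q b)) i j ∂μ

/-- Total angular momentum `∫ q × q' dμ` at time `s`, in the space-fixed frame, where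
`q = R Q` is the position in space of a material point. -/
def spaceMomentum {B : Type*} [MeasurableSpace B] (μ : Measure B) (R : ℝ → Matrix (Fin 3) (Fin 3) ℝ)
    (Q : ℝ → B → Fin 3 → ℝ) (s : ℝ) : Fin 3 → ℝ :=
  ∫ b, (R s *ᵥ Q s b) ⨯₃ (deriv (fun r => R r *ᵥ Q r b) s) ∂μ

/-- Angular velocity in the body frame: the vector `Ω` with `Ω × v = Rᵗ R' v` for all `v`
(read off from the antisymmetric matrix `Rᵗ R'`). -/
def angularVelocity (R : ℝ → Matrix (Fin 3) (Fin 3) ℝ) (s : ℝ) : Fin 3 → ℝ :=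
  let W : Matrix (Fin 3) (Fin 3) ℝ :=
    (R s)ᵀ * Matrix.of fun i j => deriv (fun r => R r i j) s
  ![W 2 1, W 0 2, W 1 0]

/-- Rotational energy `½ L · I⁻¹ L` of a body of fixed shape. -/
def energy (I : Matrix (Fin 3) (Fin 3) ℝ) (L : Fin 3 → ℝ) : ℝ :=
  (1 / 2) * (L ⬝ᵥ (I⁻¹ *ᵥ L))

/-- Rotation of `v` by the angle `α` about the unit vector `e` (right-hand rule). -/
def rotateAbout (e : Fin 3 → ℝ) (α : ℝ) (v : Fin 3 → ℝ) : Fin 3 → ℝ :=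
  Real.cos α • v + Real.sin α • (e ⨯₃ v) + ((1 - Real.cos α) * (e ⬝ᵥ v)) • e

/-! ### The full model of a twisting somersault

Body axes: `y` is the somersault axis, `z` the twist (head-to-toe) axis.  Stage `i ∈ {1, …, 5}`
is the time interval `[t (i-1), t i]`. -/

structure Dive (B : Type*) [MeasurableSpace B] where
  /-- mass distribution over the material points -/
  mass : Measure B
  /-- position, in the body frame, of each material point at each time -/
  shape : ℝ → B → Fin 3 → ℝ
  /-- orientation: the rotation from the body frame to the space-fixed frame -/
  R : ℝ → Matrix (Fin 3) (Fin 3) ℝ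
  /-- the constant angular momentum vector in the space-fixed frame -/
  ell : Fin 3 → ℝ
  /-- `t i` is the end of stage `i`; only `t 0, …, t 5` matter -/
  t : ℕ → ℝ
  t_zero : t 0 = 0
  stage_one : t 0 ≤ t 1
  stage_two : t 1 < t 2
  stage_three : t 2 ≤ t 3
  stage_four : t 3 < t 4
  stage_five : t 4 ≤ t 5
  mass_finite : IsFiniteMeasure mass
  shape_memLp : ∀ s ∈ Icc (t 0) (t 5), MemLp (shape s) 2 mass
  shape_continuousOn : ∀ b, ContinuousOn (fun s => shape s b) (Icc (t 0) (t 5))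
  shape_differentiableAt : ∀ i ∈ Icc 1 5, ∀ s ∈ Ioo (t (i - 1)) (t i), ∀ b,
    DifferentiableAt ℝ (fun r => shape r b) s
  velocity_memLp : ∀ i ∈ Icc 1 5, ∀ s ∈ Ioo (t (i - 1)) (t i),
    MemLp (fun b => deriv (fun r => shape r b) s) 2 mass
  /-- the origin of the body frame is the centre of mass -/
  centre_of_mass : ∀ s ∈ Icc (t 0) (t 5), ∫ b, shape s b ∂mass = 0
  inertia_det_ne_zero : ∀ s ∈ Icc (t 0) (t 5), (inertia mass (shape s)).det ≠ 0
  R_mem : ∀ s ∈ Icc (t 0) (t 5), R s ∈ Matrix.specialOrthogonalGroup (Fin 3) ℝ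
  /-- on each closed stage the motion is continuously differentiable (the angular velocity may
  jump between stages) -/
  R_contDiffOn : ∀ i ∈ Icc 1 5, ∀ j k, ContDiffOn ℝ 1 (fun s => R s j k) (Icc (t (i - 1)) (t i))
  ell_ne_zero : ell ≠ 0
  /-- conservation of angular momentum -/
  momentum_conserved : ∀ i ∈ Icc 1 5, ∀ s ∈ Ioo (t (i - 1)) (t i),
    spaceMomentum mass R shape s = ell
  /-- no shape change in stages 1, 3 and 5 -/
  shape_fixed : ∀ i ∈ ({1, 3, 5} : Set ℕ), ∀ s ∈ Icc (t (i - 1)) (t i), shape s = shape (t i)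
  /-- stages 1 and 5 have the same tensor of inertia -/
  inertia_eq : inertia mass (shape (t 5)) = inertia mass (shape (t 0))
  /-- stages 1 and 5 are pure somersault: the body-frame angular momentum `Rᵗ ell` rests at
  `(0, l, 0)` -/
  pure_somersault : ∀ s ∈ Icc (t 0) (t 1) ∪ Icc (t 4) (t 5),
    (R s)ᵀ *ᵥ ell = ![0, √(ell ⬝ᵥ ell), 0]

namespace Dive

variable {B : Type*} [MeasurableSpace B] (d : Dive B)

/-- Length `l` of the angular momentum. -/
def l : ℝ := √(d.ell ⬝ᵥ d.ell)

/-- Angular momentum in the body frame, `ell = R L`. -/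
def L (s : ℝ) : Fin 3 → ℝ := (d.R s)ᵀ *ᵥ d.ell

/-- Angular velocity in the body frame. -/
def Ω (s : ℝ) : Fin 3 → ℝ := angularVelocity d.R s

/-- Duration of stage `i`. -/
def τ (i : ℕ) : ℝ := d.t i - d.t (i - 1)

/-- Tensor of inertia in the somersault stages 1 and 5. -/
def Is : Matrix (Fin 3) (Fin 3) ℝ := inertia d.mass (d.shape (d.t 0))

/-- Tensor of inertia in the twisting stage 3. -/
def It : Matrix (Fin 3) (Fin 3) ℝ := inertia d.mass (d.shape (d.t 2))

/-- Energy in the somersault stages. -/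
def Es : ℝ := energy d.Is ![0, d.l, 0]

/-- Energy in the twisting stage, evaluated at the end of stage 2. -/
def Et : ℝ := energy d.It (d.L (d.t 2))

/-- Average energy during stage `i`. -/
def Ebar (i : ℕ) : ℝ :=
  1 / (2 * d.τ i) * ∫ s in (d.t (i - 1))..(d.t i), d.L s ⬝ᵥ d.Ω s

/-- `φ` is a continuous determination of the angle of rotation about the fixed axis `ell`:
the component orthogonal to `ell` of the head-to-toe axis `R e_z` has azimuth `φ` about `ell`,
counted from its initial direction (which is orthogonal to `ell`). -/
def IsRotationAngle (φ : ℝ → ℝ) : Prop :=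
  ContinuousOn φ (Icc (d.t 0) (d.t 5)) ∧
  ∀ s ∈ Icc (d.t 0) (d.t 5), ∃ c r : ℝ, 0 < r ∧
    d.R s *ᵥ ![0, 0, 1] = c • d.ell +
      r • (Real.cos (φ s) • (d.R (d.t 0) *ᵥ ![0, 0, 1]) +
        Real.sin (φ s) • ((d.l⁻¹ • d.ell) ⨯₃ (d.R (d.t 0) *ᵥ ![0, 0, 1])))

end Dive

/-! ### The twisting orbit and solid angles -/

/-- `γ` is a solution, for all times, of the Euler equations of a rigid body with tensor of
inertia `I`. -/
def IsEulerOrbit (I : Matrix (Fin 3) (Fin 3) ℝ) (γ : ℝ → Fin 3 → ℝ) : Prop :=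
  ∀ s, HasDerivAt γ (γ s ⨯₃ (I⁻¹ *ᵥ γ s)) s

/-- `T` is the (least positive) period of `γ`. -/
def IsLeastPeriod (γ : ℝ → Fin 3 → ℝ) (T : ℝ) : Prop :=
  0 < T ∧ Function.Periodic γ T ∧ ∀ T' ∈ Ioo 0 T, ¬ Function.Periodic γ T'

/-- A region on the sphere of radius `l`, parametrised by the unit square, that does not contain
the poles `±(0, 0, l)`. -/
def IsSphericalRegion (l : ℝ) (F : ℝ → ℝ → Fin 3 → ℝ) : Prop :=
  ContDiffOn ℝ 2 (fun p : ℝ × ℝ => F p.1 p.2) (Icc 0 1 ×ˢ Icc 0 1) ∧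
  ∀ u ∈ Icc (0 : ℝ) 1, ∀ v ∈ Icc (0 : ℝ) 1,
    F u v ⬝ᵥ F u v = l ^ 2 ∧ ¬ (F u v 0 = 0 ∧ F u v 1 = 0)

/-- The solid angle `∬ r · dA / |r|³` subtended at the origin by a parametrised surface, counted
positively where the orientation `∂F/∂u × ∂F/∂v` points outwards. -/
def solidAngle (F : ℝ → ℝ → Fin 3 → ℝ) : ℝ :=
  ∫ u in (0 : ℝ)..1, ∫ v in (0 : ℝ)..1,
    (F u v ⬝ᵥ (deriv (fun u' => F u' v) u ⨯₃ deriv (fun v' => F u v') v)) /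
      √(F u v ⬝ᵥ F u v) ^ 3

/-- The band between a closed orbit `γ` of period `T` (edge `v = 0`) and the equator `z = 0`
(edge `v = 1`); the orbit is traversed in its own direction. -/
def IsBandToEquator (l T : ℝ) (γ : ℝ → Fin 3 → ℝ) (F : ℝ → ℝ → Fin 3 → ℝ) : Prop :=
  IsSphericalRegion l F ∧
  (∀ u ∈ Icc (0 : ℝ) 1, F u 0 = γ (T * u) ∧ F u 1 2 = 0) ∧
  (∀ v ∈ Icc (0 : ℝ) 1, F 0 v = F 1 v)

namespace Dive

variable {B : Type*} [MeasurableSpace B] (d : Dive B)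

/-- The triangle on the sphere of angular momenta with vertex `(0, l, 0)` (edge `u = 0`,
collapsed), whose sides are stage 4 run backwards (`v = 0`), the part of the stage 3 orbit from
the end of stage 3 (time `τ₃` on the orbit) to the end of stage 2 (time `n T`, that is time `0`)
(`u = 1`), and stage 2 (`v = 1`). -/
def IsTriangle (n : ℕ) (T : ℝ) (γ : ℝ → Fin 3 → ℝ) (G : ℝ → ℝ → Fin 3 → ℝ) : Prop :=
  IsSphericalRegion d.l G ∧
  (∀ u ∈ Icc (0 : ℝ) 1, G u 0 = d.L (d.t 4 - u * d.τ 4) ∧ G u 1 = d.L (d.t 1 + u * d.τ 2)) ∧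
  (∀ v ∈ Icc (0 : ℝ) 1, G 0 v = ![0, d.l, 0] ∧ G 1 v = γ (d.τ 3 + v * (n * T - d.τ 3)))

/-- Rotation in the kick-model with `n` twists, where `S` is the solid angle of the twisting
orbit. -/
def kickRotation (n : ℕ) (S : ℝ) : ℝ :=
  (d.τ 1 + d.τ 5) * (2 * d.Es / d.l) + d.τ 3 * (2 * d.Et / d.l) - n * S

end Dive

end Somersault

end

noncomputable section

/-! ### The one-form `z dα` and its integrals along curves -/

namespace Somersault

/-- The one-form `z dα` on `ℝ³` minus the `z`-axis, where `α` is the azimuth about the `z`-axis. -/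
def azimuthForm (c w : Fin 3 → ℝ) : ℝ :=
  c 2 * (c 0 * w 1 - c 1 * w 0) / (c 0 ^ 2 + c 1 ^ 2)

/-- The integral of `z dα` along a curve. -/
def azimuthIntegral (c : ℝ → Fin 3 → ℝ) (a b : ℝ) : ℝ :=
  ∫ s in a..b, azimuthForm (c s) (deriv c s)

theorem sq_add_sq_ne_zero {x y : ℝ} (h : ¬ (x = 0 ∧ y = 0)) : x ^ 2 + y ^ 2 ≠ 0 := by
  intro h0
  apply h
  constructor <;> nlinarith [sq_nonneg x, sq_nonneg y]

/-- Endpoints are null sets. They have to be dropped because `deriv` carries no information at the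
ends of a stage or on the edges of the unit square. -/
theorem integral_congr_Ioo {E : Type*} [NormedAddCommGroup E] [NormedSpace ℝ E] {f g : ℝ → E}
    {a b : ℝ} (hab : a ≤ b) (h : EqOn f g (Ioo a b)) : ∫ s in a..b, f s = ∫ s in a..b, g s := by
  rw [intervalIntegral.integral_of_le hab, intervalIntegral.integral_of_le hab,
    integral_Ioc_eq_integral_Ioo, integral_Ioc_eq_integral_Ioo]
  exact setIntegral_congr_fun measurableSet_Ioo h

theorem azimuthIntegral_congr {c c' : ℝ → Fin 3 → ℝ} {a b : ℝ} (hab : a ≤ b)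
    (h : EqOn c c' (Ioo a b)) : azimuthIntegral c a b = azimuthIntegral c' a b := by
  refine integral_congr_Ioo hab fun s hs => ?_
  have : c =ᶠ[nhds s] c' := Filter.eventuallyEq_of_mem (Ioo_mem_nhds hs.1 hs.2) h
  simp only [this.deriv_eq, h hs]

theorem azimuthForm_zero (c : Fin 3 → ℝ) : azimuthForm c 0 = 0 := by simp [azimuthForm]

theorem azimuthForm_smul (c w : Fin 3 → ℝ) (k : ℝ) :
    azimuthForm c (k • w) = k * azimuthForm c w := by
  simp only [azimuthForm, Pi.smul_apply, smul_eq_mul]; ring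

theorem azimuthIntegral_of_const {c : ℝ → Fin 3 → ℝ} {p : Fin 3 → ℝ} {a b : ℝ} (hab : a ≤ b)
    (h : ∀ s ∈ Ioo a b, c s = p) : azimuthIntegral c a b = 0 := by
  rw [azimuthIntegral_congr (c' := fun _ => p) hab h]
  simp [azimuthIntegral, azimuthForm_zero]

theorem azimuthIntegral_of_equator {c : ℝ → Fin 3 → ℝ} {a b : ℝ} (hab : a ≤ b)
    (h : ∀ s ∈ Ioo a b, c s 2 = 0) : azimuthIntegral c a b = 0 := by
  rw [azimuthIntegral, integral_congr_Ioo hab (g := fun _ => 0)]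
  · simp
  · intro s hs
    simp [azimuthForm, h s hs]

/-- Affine reparametrisation of the integral of `z dα`. -/
theorem azimuthIntegral_comp_add_mul (c : ℝ → Fin 3 → ℝ) (k d a b : ℝ) :
    azimuthIntegral (fun s => c (d + k * s)) a b = azimuthIntegral c (d + k * a) (d + k * b) := by
  have h (s : ℝ) : deriv (fun s => c (d + k * s)) s = k • deriv c (d + k * s) := by
    have := deriv_comp_mul_left k (fun x => c (d + x)) s
    rw [this, deriv_comp_const_add]
  simp only [azimuthIntegral, h, azimuthForm_smul]
  rw [intervalIntegral.integral_const_mul]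
  exact intervalIntegral.mul_integral_comp_add_mul (f := fun s => azimuthForm (c s) (deriv c s)) (c := k) (d := d)

theorem azimuthForm_contDiffOn {E : Type*} [NormedAddCommGroup E] [NormedSpace ℝ E] {s : Set E}
    {c w : E → Fin 3 → ℝ} {n : WithTop ℕ∞} (hc : ContDiffOn ℝ n c s) (hw : ContDiffOn ℝ n w s)
    (h0 : ∀ p ∈ s, ¬ (c p 0 = 0 ∧ c p 1 = 0)) :
    ContDiffOn ℝ n (fun p => azimuthForm (c p) (w p)) s := by
  have hc' := contDiffOn_pi.1 hc
  have hw' := contDiffOn_pi.1 hw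
  exact ((hc' 2).mul (((hc' 0).mul (hw' 1)).sub ((hc' 1).mul (hw' 0)))).div
    (((hc' 0).pow 2).add ((hc' 1).pow 2)) fun p hp => sq_add_sq_ne_zero (h0 p hp)

theorem azimuthForm_continuousOn {E : Type*} [TopologicalSpace E] {s : Set E}
    {c w : E → Fin 3 → ℝ} (hc : ContinuousOn c s) (hw : ContinuousOn w s)
    (h0 : ∀ p ∈ s, ¬ (c p 0 = 0 ∧ c p 1 = 0)) :
    ContinuousOn (fun p => azimuthForm (c p) (w p)) s := by
  have hc' := continuousOn_pi.1 hc
  have hw' := continuousOn_pi.1 hw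
  exact ((hc' 2).mul (((hc' 0).mul (hw' 1)).sub ((hc' 1).mul (hw' 0)))).div
    (((hc' 0).pow 2).add ((hc' 1).pow 2)) fun p hp => sq_add_sq_ne_zero (h0 p hp)

/-! ### Stokes' theorem on the sphere -/

/-- The quotient rule, with `w` independent of `c`: in Stokes' theorem `w` is the partial derivative
of the surface in the direction other than that of differentiation. -/
theorem azimuthForm_hasDerivAt {c w : ℝ → Fin 3 → ℝ} {c' w' : Fin 3 → ℝ} {s : ℝ}
    (hc : HasDerivAt c c' s) (hw : HasDerivAt w w' s) (h0 : ¬ (c s 0 = 0 ∧ c s 1 = 0)) :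
    HasDerivAt (fun s => azimuthForm (c s) (w s))
      (((c' 2 * (c s 0 * w s 1 - c s 1 * w s 0) +
        c s 2 * (c' 0 * w s 1 + c s 0 * w' 1 - (c' 1 * w s 0 + c s 1 * w' 0))) *
          (c s 0 ^ 2 + c s 1 ^ 2) -
        c s 2 * (c s 0 * w s 1 - c s 1 * w s 0) * (2 * c s 0 * c' 0 + 2 * c s 1 * c' 1)) /
          (c s 0 ^ 2 + c s 1 ^ 2) ^ 2) s := by
  have hc' := hasDerivAt_pi.1 hc
  have hw' := hasDerivAt_pi.1 hw
  refine (((hc' 2).mul (((hc' 0).mul (hw' 1)).sub ((hc' 1).mul (hw' 0)))).div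
    (((hc' 0).pow 2).add ((hc' 1).pow 2)) (sq_add_sq_ne_zero h0)).congr_deriv ?_
  simp

/-- The exterior derivative of `z dα` on a sphere of radius `l` is `-l⁻¹` times the area form. -/
theorem azimuthForm_curl {l : ℝ} (hl : 0 < l) (c cu cv cuv : Fin 3 → ℝ) (hc : c ⬝ᵥ c = l ^ 2)
    (hu : c ⬝ᵥ cu = 0) (hv : c ⬝ᵥ cv = 0) (h0 : ¬ (c 0 = 0 ∧ c 1 = 0)) :
    (((cu 2 * (c 0 * cv 1 - c 1 * cv 0) +
        c 2 * (cu 0 * cv 1 + c 0 * cuv 1 - (cu 1 * cv 0 + c 1 * cuv 0))) *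
          (c 0 ^ 2 + c 1 ^ 2) -
        c 2 * (c 0 * cv 1 - c 1 * cv 0) * (2 * c 0 * cu 0 + 2 * c 1 * cu 1)) /
          (c 0 ^ 2 + c 1 ^ 2) ^ 2) -
    (((cv 2 * (c 0 * cu 1 - c 1 * cu 0) +
        c 2 * (cv 0 * cu 1 + c 0 * cuv 1 - (cv 1 * cu 0 + c 1 * cuv 0))) *
          (c 0 ^ 2 + c 1 ^ 2) -
        c 2 * (c 0 * cu 1 - c 1 * cu 0) * (2 * c 0 * cv 0 + 2 * c 1 * cv 1)) /
          (c 0 ^ 2 + c 1 ^ 2) ^ 2) =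
      -l * ((c ⬝ᵥ (cu ⨯₃ cv)) / √(c ⬝ᵥ c) ^ 3) := by
  have hρ := sq_add_sq_ne_zero h0
  rw [hc, Real.sqrt_sq hl.le]
  simp only [dotProduct, Fin.sum_univ_three, cross_apply, Matrix.cons_val] at *
  generalize c 0 = x at *
  generalize c 1 = y at *
  generalize c 2 = z at *
  have hl2 : -l * ((x * (cu 1 * cv 2 - cu 2 * cv 1) + y * (cu 2 * cv 0 - cu 0 * cv 2) +
      z * (cu 0 * cv 1 - cu 1 * cv 0)) / l ^ 3) =
      -((x * (cu 1 * cv 2 - cu 2 * cv 1) + y * (cu 2 * cv 0 - cu 0 * cv 2) +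
      z * (cu 0 * cv 1 - cu 1 * cv 0)) / (x * x + y * y + z * z)) := by
    rw [hc]; field_simp
  rw [hl2]
  have hr : x * x + y * y + z * z ≠ 0 := by rw [hc]; positivity
  -- Since `dα` is closed, only `dz ∧ dα` survives. Tangency of `cu` and `cv` to the sphere turns it
  -- into the area form; the `cuv` terms cancel in the final `ring`.
  have key : (cu 2 * (x * cv 1 - y * cv 0) - cv 2 * (x * cu 1 - y * cu 0)) *
      (x * x + y * y + z * z) = -(x * (cu 1 * cv 2 - cu 2 * cv 1) +
        y * (cu 2 * cv 0 - cu 0 * cv 2) + z * (cu 0 * cv 1 - cu 1 * cv 0)) * (x ^ 2 + y ^ 2) := by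
    linear_combination (z * (x * cv 1 - y * cv 0)) * hu - (z * (x * cu 1 - y * cu 0)) * hv
  have e : (cu 2 * (x * cv 1 - y * cv 0) - cv 2 * (x * cu 1 - y * cu 0)) / (x ^ 2 + y ^ 2) =
      -((x * (cu 1 * cv 2 - cu 2 * cv 1) + y * (cu 2 * cv 0 - cu 0 * cv 2) +
      z * (cu 0 * cv 1 - cu 1 * cv 0)) / (x * x + y * y + z * z)) := by
    rw [← neg_div, div_eq_div_iff hρ hr, key]
  rw [← e, ← sub_div, div_eq_div_iff (pow_ne_zero 2 hρ) hρ]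
  ring

/-- The frozen coordinate may lie on an edge of the square, so that the tangential derivatives of
boundary curves are also values of `fderivWithin`. -/
theorem hasDerivAt_fst_slice {E : Type*} [NormedAddCommGroup E] [NormedSpace ℝ E] {f : ℝ × ℝ → E}
    {u v : ℝ} (hf : DifferentiableOn ℝ f (Icc 0 1 ×ˢ Icc 0 1)) (hu : u ∈ Ioo (0 : ℝ) 1)
    (hv : v ∈ Icc (0 : ℝ) 1) :
    HasDerivAt (fun r => f (r, v)) (fderivWithin ℝ f (Icc 0 1 ×ˢ Icc 0 1) (u, v) (1, 0)) u := by
  have h1 := (hf (u, v) ⟨Ioo_subset_Icc_self hu, hv⟩).hasFDerivWithinAt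
  have h2 : HasDerivWithinAt (fun r : ℝ => (r, v)) ((1, 0) : ℝ × ℝ) (Icc 0 1) u :=
    ((hasDerivAt_id u).prodMk (hasDerivAt_const u v)).hasDerivWithinAt
  have h3 : MapsTo (fun r : ℝ => (r, v)) (Icc 0 1) (Icc (0 : ℝ) 1 ×ˢ Icc (0 : ℝ) 1) :=
    fun r hr => ⟨hr, hv⟩
  exact (h1.comp_hasDerivWithinAt u h2 h3).hasDerivAt (Icc_mem_nhds hu.1 hu.2)

theorem hasDerivAt_snd_slice {E : Type*} [NormedAddCommGroup E] [NormedSpace ℝ E] {f : ℝ × ℝ → E}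
    {u v : ℝ} (hf : DifferentiableOn ℝ f (Icc 0 1 ×ˢ Icc 0 1)) (hu : u ∈ Icc (0 : ℝ) 1)
    (hv : v ∈ Ioo (0 : ℝ) 1) :
    HasDerivAt (fun r => f (u, r)) (fderivWithin ℝ f (Icc 0 1 ×ˢ Icc 0 1) (u, v) (0, 1)) v := by
  have h1 := (hf (u, v) ⟨hu, Ioo_subset_Icc_self hv⟩).hasFDerivWithinAt
  have h2 : HasDerivWithinAt (fun r : ℝ => (u, r)) ((0, 1) : ℝ × ℝ) (Icc 0 1) v :=
    ((hasDerivAt_const v u).prodMk (hasDerivAt_id v)).hasDerivWithinAt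
  have h3 : MapsTo (fun r : ℝ => (u, r)) (Icc 0 1) (Icc (0 : ℝ) 1 ×ˢ Icc (0 : ℝ) 1) :=
    fun r hr => ⟨hu, hr⟩
  exact (h1.comp_hasDerivWithinAt v h2 h3).hasDerivAt (Icc_mem_nhds hv.1 hv.2)

theorem dotProduct_deriv_eq_zero {c : ℝ → Fin 3 → ℝ} {c' : Fin 3 → ℝ} {s k : ℝ}
    (hc : HasDerivAt c c' s) (h : ∀ᶠ r in nhds s, c r ⬝ᵥ c r = k) : c s ⬝ᵥ c' = 0 := by
  have hc' := hasDerivAt_pi.1 hc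
  have h1 := (((hc' 0).mul (hc' 0)).add ((hc' 1).mul (hc' 1))).add ((hc' 2).mul (hc' 2))
  have h2 : HasDerivAt (fun r => c r ⬝ᵥ c r) 0 s :=
    (hasDerivAt_const s k).congr_of_eventuallyEq h
  simp only [dotProduct, Fin.sum_univ_three] at h2 ⊢
  have := h1.unique h2
  linarith

/-- Stokes' theorem for `z dα` on a parametrised region of a sphere avoiding the poles. -/
theorem stokes_azimuthForm {l : ℝ} (hl : 0 < l) {F : ℝ → ℝ → Fin 3 → ℝ}
    (hF : IsSphericalRegion l F) :
    azimuthIntegral (fun u => F u 0) 0 1 + azimuthIntegral (fun v => F 1 v) 0 1 -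
      azimuthIntegral (fun u => F u 1) 0 1 - azimuthIntegral (fun v => F 0 v) 0 1 =
      -l * solidAngle F := by
  obtain ⟨hC, hS⟩ := hF
  set S : Set (ℝ × ℝ) := Icc 0 1 ×ˢ Icc 0 1 with hSdef
  set f : ℝ × ℝ → Fin 3 → ℝ := fun p => F p.1 p.2 with hf
  have hUD : UniqueDiffOn ℝ S := (uniqueDiffOn_Icc zero_lt_one).prod (uniqueDiffOn_Icc zero_lt_one)
  set D := fderivWithin ℝ f S with hD
  have hDC : ContDiffOn ℝ 1 D S := hC.fderivWithin hUD (by norm_num)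
  have hDd : DifferentiableOn ℝ D S := hDC.differentiableOn (by norm_num)
  have hfd : DifferentiableOn ℝ f S := hC.differentiableOn (by norm_num)
  have h0 : ∀ p ∈ S, ¬ (f p 0 = 0 ∧ f p 1 = 0) := fun p hp => (hS p.1 hp.1 p.2 hp.2).2
  set Q : ℝ × ℝ → ℝ := fun p => azimuthForm (f p) (D p (0, 1)) with hQ
  set P : ℝ × ℝ → ℝ := fun p => azimuthForm (f p) (D p (1, 0)) with hP
  have hQC : ContDiffOn ℝ 1 Q S := azimuthForm_contDiffOn (hC.of_le (by norm_num))
    (hDC.clm_apply contDiffOn_const) h0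
  have hPC : ContDiffOn ℝ 1 P S := azimuthForm_contDiffOn (hC.of_le (by norm_num))
    (hDC.clm_apply contDiffOn_const) h0
  have hQd := hQC.differentiableOn (by norm_num)
  have hPd := hPC.differentiableOn (by norm_num)
  have hnhds : ∀ x ∈ Ioo (0 : ℝ) 1 ×ˢ Ioo (0 : ℝ) 1, S ∈ nhds x := fun x hx =>
    prod_mem_nhds (Icc_mem_nhds hx.1.1 hx.1.2) (Icc_mem_nhds hx.2.1 hx.2.2)
  -- The divergence of `(Q, -P)` is the curl of the pulled-back form `P du + Q dv`.
  have hdiv := integral2_divergence_prod_of_hasFDerivAt Q (-P)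
    (fderivWithin ℝ Q S) (fun p => -fderivWithin ℝ P S p) 0 0 1 1
    (by simpa only [zero_le_one, uIcc_of_le] using hQC.continuousOn)
    (by simpa only [zero_le_one, uIcc_of_le] using hPC.continuousOn.neg)
    (by
      intro x hx
      simp only [zero_le_one, min_eq_left, max_eq_right] at hx
      have hxS : x ∈ S := mem_of_mem_nhds (hnhds x hx)
      exact (hQd x hxS).hasFDerivWithinAt.hasFDerivAt (hnhds x hx))
    (by
      intro x hx
      simp only [zero_le_one, min_eq_left, max_eq_right] at hx
      have hxS : x ∈ S := mem_of_mem_nhds (hnhds x hx)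
      exact ((hPd x hxS).hasFDerivWithinAt.hasFDerivAt (hnhds x hx)).neg)
    (by
      simp only [zero_le_one, uIcc_of_le]
      refine ContinuousOn.integrableOn_compact (isCompact_Icc.prod isCompact_Icc) ?_
      exact ((hQC.continuousOn_fderivWithin hUD (by norm_num)).clm_apply continuousOn_const).add
        ((hPC.continuousOn_fderivWithin hUD (by norm_num)).neg.clm_apply continuousOn_const))
  have hU : ∀ u ∈ Ioo (0 : ℝ) 1, ∀ v ∈ Icc (0 : ℝ) 1,
      HasDerivAt (fun r => F r v) (D (u, v) (1, 0)) u := fun u hu v hv =>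
    hasDerivAt_fst_slice hfd hu hv
  have hV : ∀ u ∈ Icc (0 : ℝ) 1, ∀ v ∈ Ioo (0 : ℝ) 1,
      HasDerivAt (fun r => F u r) (D (u, v) (0, 1)) v := fun u hu v hv =>
    hasDerivAt_snd_slice hfd hu hv
  have hPint : ∀ v ∈ Icc (0 : ℝ) 1, ∫ u in (0 : ℝ)..1, P (u, v) =
      azimuthIntegral (fun u => F u v) 0 1 := fun v hv =>
    integral_congr_Ioo zero_le_one fun u hu => by simp only [hP, hf, (hU u hu v hv).deriv]
  have hQint : ∀ u ∈ Icc (0 : ℝ) 1, ∫ v in (0 : ℝ)..1, Q (u, v) =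
      azimuthIntegral (fun v => F u v) 0 1 := fun u hu =>
    integral_congr_Ioo zero_le_one fun v hv => by simp only [hQ, hf, (hV u hu v hv).deriv]
  have hcurl : ∫ u in (0 : ℝ)..1, ∫ v in (0 : ℝ)..1,
      (fderivWithin ℝ Q S (u, v) (1, 0) + (-fderivWithin ℝ P S (u, v)) (0, 1)) =
      -l * solidAngle F := by
    rw [solidAngle, ← intervalIntegral.integral_const_mul]
    refine integral_congr_Ioo zero_le_one fun u hu => ?_
    rw [← intervalIntegral.integral_const_mul]
    refine integral_congr_Ioo zero_le_one fun v hv => ?_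
    have hu' := Ioo_subset_Icc_self hu
    have hv' := Ioo_subset_Icc_self hv
    have hcu := hU u hu v hv'
    have hcv := hV u hu' v hv
    have hDu := (hasDerivAt_fst_slice hDd hu hv').clm_apply (hasDerivAt_const u ((0, 1) : ℝ × ℝ))
    have hDv := (hasDerivAt_snd_slice hDd hu' hv).clm_apply (hasDerivAt_const v ((1, 0) : ℝ × ℝ))
    -- Symmetry of second derivatives makes the same mixed derivative appear in `h1` and `h2`, as
    -- `azimuthForm_curl` requires.
    have hsymm := (hC (u, v) ⟨hu', hv'⟩).isSymmSndFDerivWithinAt (by simp) hUD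
      (subset_closure (mem_interior_iff_mem_nhds.2 (hnhds (u, v) ⟨hu, hv⟩))) ⟨hu', hv'⟩
      (1, 0) (0, 1)
    have h1 := (azimuthForm_hasDerivAt hcu hDu (h0 (u, v) ⟨hu', hv'⟩)).unique
      (hasDerivAt_fst_slice hQd hu hv')
    have h2 := (azimuthForm_hasDerivAt hcv hDv (h0 (u, v) ⟨hu', hv'⟩)).unique
      (hasDerivAt_snd_slice hPd hu' hv)
    simp only [map_zero, add_zero] at h1 h2
    rw [← hD] at hsymm
    rw [← hSdef] at h1 h2
    rw [← hsymm] at h2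
    have hsu := dotProduct_deriv_eq_zero hcu (k := l ^ 2) (by
      filter_upwards [Ioo_mem_nhds hu.1 hu.2] with r hr using
        (hS r (Ioo_subset_Icc_self hr) v hv').1)
    have hsv := dotProduct_deriv_eq_zero hcv (k := l ^ 2) (by
      filter_upwards [Ioo_mem_nhds hv.1 hv.2] with r hr using
        (hS u hu' r (Ioo_subset_Icc_self hr)).1)
    have h3 := azimuthForm_curl hl (F u v) _ _ (fderivWithin ℝ D S (u, v) (1, 0) (0, 1))
      (hS u hu' v hv').1 hsu hsv (hS u hu' v hv').2
    simp only [neg_apply, ← sub_eq_add_neg]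
    rw [hcu.deriv, hcv.deriv, ← h3, ← h1, ← h2]
  rw [hcurl] at hdiv
  simp only [Pi.neg_apply, intervalIntegral.integral_neg] at hdiv
  rw [hPint 0 (by simp), hPint 1 (by simp), hQint 0 (by simp), hQint 1 (by simp)] at hdiv
  linarith

/-! ### Integrated logarithmic derivatives and continuous angles -/

/-- The logarithmic derivative of `w` is integrable on `[a, b]`, and its integral is a logarithm
of `w b / w a`. -/
def HasLogIntegral (w : ℝ → ℂ) (a b : ℝ) : Prop :=
  IntervalIntegrable (fun s => deriv w s / w s) volume a b ∧
    w b = w a * Complex.exp (∫ s in a..b, deriv w s / w s)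

theorem HasLogIntegral.trans {w : ℝ → ℂ} {a b c : ℝ} (h : HasLogIntegral w a b)
    (h' : HasLogIntegral w b c) : HasLogIntegral w a c := by
  refine ⟨h.1.trans h'.1, ?_⟩
  rw [h'.2, h.2, ← intervalIntegral.integral_add_adjacent_intervals h.1 h'.1, Complex.exp_add,
    mul_assoc]

theorem intervalIntegrable_congr_Ioo {E : Type*} [NormedAddCommGroup E] {f g : ℝ → E}
    {a b : ℝ} (hab : a ≤ b) (h : EqOn f g (Ioo a b)) (hg : ContinuousOn g (Icc a b)) :
    IntervalIntegrable f volume a b := by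
  rw [intervalIntegrable_iff_integrableOn_Ioo_of_le hab]
  exact ((hg.integrableOn_Icc).mono_set Ioo_subset_Icc_self).congr_fun h.symm measurableSet_Ioo

theorem eqOn_deriv_derivWithin_Icc {E : Type*} [NormedAddCommGroup E] [NormedSpace ℝ E]
    (f : ℝ → E) (a b : ℝ) : EqOn (deriv f) (derivWithin f (Icc a b)) (Ioo a b) :=
  fun _ hs => (derivWithin_of_mem_nhds (Icc_mem_nhds hs.1 hs.2)).symm

/-- The product of `w` and `exp (-∫ w'/w)` has derivative zero, so no branch of the logarithm has to
be chosen. -/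
theorem hasLogIntegral_of_contDiffOn {w : ℝ → ℂ} {a b : ℝ} (hab : a ≤ b)
    (hw : ContDiffOn ℝ 1 w (Icc a b)) (h0 : ∀ s ∈ Icc a b, w s ≠ 0) : HasLogIntegral w a b := by
  rcases hab.eq_or_lt with rfl | hlt
  · simp [HasLogIntegral]
  have hd := hw.continuousOn_derivWithin (uniqueDiffOn_Icc hlt) le_rfl
  have hh : ContinuousOn (fun s => derivWithin w (Icc a b) s / w s) (Icc a b) :=
    hd.div hw.continuousOn h0
  have hEq : EqOn (fun s => deriv w s / w s) (fun s => derivWithin w (Icc a b) s / w s)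
      (Ioo a b) := fun s hs => by simp only [eqOn_deriv_derivWithin_Icc w a b hs]
  have hint := intervalIntegrable_congr_Ioo hab hEq hh
  refine ⟨hint, ?_⟩
  set H : ℝ → ℂ := fun s => ∫ r in a..s, deriv w r / w r with hH
  have hHc : ContinuousOn H (Icc a b) := by
    have := intervalIntegral.continuousOn_primitive_interval' hint left_mem_uIcc
    rwa [uIcc_of_le hab] at this
  have hcO : ContinuousOn (fun s => deriv w s / w s) (Ioo a b) :=
    (hh.mono Ioo_subset_Icc_self).congr hEq
  have hK : ∀ s ∈ Ioo a b, HasDerivAt (fun s => w s * Complex.exp (-H s)) 0 s := by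
    intro s hs
    have hHd : HasDerivAt H (deriv w s / w s) s :=
      intervalIntegral.integral_hasDerivAt_right
        (hint.mono_set (uIcc_subset_uIcc left_mem_uIcc
          (by rw [uIcc_of_le hab]; exact Ioo_subset_Icc_self hs)))
        (hcO.stronglyMeasurableAtFilter isOpen_Ioo s hs) (hcO.continuousAt (Ioo_mem_nhds hs.1 hs.2))
    have hwd : HasDerivAt w (deriv w s) s :=
      ((hw.differentiableOn (by norm_num) s (Ioo_subset_Icc_self hs)).differentiableAt
        (Icc_mem_nhds hs.1 hs.2)).hasDerivAt
    refine (hwd.mul hHd.neg.cexp).congr_deriv ?_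
    have := h0 s (Ioo_subset_Icc_self hs)
    simp only [Pi.neg_apply]
    field_simp
    ring
  have := intervalIntegral.integral_eq_sub_of_hasDerivAt_of_le hab
    (f := fun s => w s * Complex.exp (-H s))
    (hw.continuousOn.mul (hHc.neg.cexp)) hK (by simp)
  have hHa : H a = 0 := by simp [hH]
  simp only [intervalIntegral.integral_zero, hHa, neg_zero, Complex.exp_zero, mul_one] at this
  rw [← sub_eq_zero.1 this.symm, mul_assoc, ← Complex.exp_add]
  simp [hH]

/-- Jumps of `w'` between stages are harmless, because logarithmic integrals add. The endpoint `s`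
is arbitrary so that the angle is obtained at every time. -/
theorem hasLogIntegral_of_partition {w : ℝ → ℂ} {t : ℕ → ℝ} {N : ℕ}
    (ht : ∀ i < N, t i ≤ t (i + 1))
    (hw : ∀ i < N, ContDiffOn ℝ 1 w (Icc (t i) (t (i + 1))))
    (h0 : ∀ i < N, ∀ s ∈ Icc (t i) (t (i + 1)), w s ≠ 0) :
    ∀ k ≤ N, ∀ s ∈ Icc (t 0) (t k), HasLogIntegral w (t 0) s := by
  intro k
  induction k with
  | zero =>
    intro _ s hs
    rw [le_antisymm hs.2 hs.1]
    simp [HasLogIntegral]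
  | succ k ih =>
    intro hk s hs
    rcases le_total s (t k) with h | h
    · exact ih (by omega) s ⟨hs.1, h⟩
    have hmono : ∀ j ≤ k, t 0 ≤ t j := by
      intro j
      induction j with
      | zero => exact fun _ => le_rfl
      | succ j ihj => exact fun hj => (ihj (by omega)).trans (ht j (by omega))
    refine (ih (by omega) (t k) ⟨hmono k le_rfl, le_rfl⟩).trans
      (hasLogIntegral_of_contDiffOn h ((hw k hk).mono (Icc_subset_Icc_right hs.2))
        fun r hr => h0 k hk r ⟨hr.1, hr.2.trans hs.2⟩)

/-- Two continuous determinations of the same angle differ by a constant. -/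
theorem sub_eq_sub_of_cos_sin_eq {φ ψ : ℝ → ℝ} {a b : ℝ} (hab : a ≤ b)
    (hφ : ContinuousOn φ (Icc a b)) (hψ : ContinuousOn ψ (Icc a b))
    (hc : ∀ s ∈ Icc a b, Real.cos (φ s) = Real.cos (ψ s))
    (hs : ∀ s ∈ Icc a b, Real.sin (φ s) = Real.sin (ψ s)) : φ b - φ a = ψ b - ψ a := by
  -- The difference lies in `2πℤ`, which is discrete, so it is constant on the connected interval.
  have hmaps : MapsTo (fun s => (φ s - ψ s) / (2 * Real.pi)) (Icc a b)
      (range ((↑) : ℤ → ℝ)) := by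
    intro s h
    have h1 : Real.cos (φ s - ψ s) = 1 := by
      rw [Real.cos_sub, hc s h, hs s h]
      nlinarith [Real.sin_sq_add_cos_sq (ψ s)]
    obtain ⟨k, hk⟩ := (Real.cos_eq_one_iff _).1 h1
    refine ⟨k, ?_⟩
    beta_reduce
    rw [← hk]
    field_simp
  have hdisc : IsDiscrete (range ((↑) : ℤ → ℝ)) :=
    Int.isClosedEmbedding_coe_real.isInducing.isDiscrete_range
  have := isPreconnected_Icc.constant_of_mapsTo hdisc ((hφ.sub hψ).div_const _) hmaps
    (left_mem_Icc.2 hab) (right_mem_Icc.2 hab)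
  have hpi : 2 * Real.pi ≠ 0 := by positivity
  rw [div_left_inj' hpi] at this
  simp only [Pi.sub_apply] at this
  linarith

/-! ### Rotation matrices and the momentum of a rigid body -/

/-- The matrix of cofactors of a rotation is the rotation itself. -/
theorem specialOrthogonal_cofactor {A : Matrix (Fin 3) (Fin 3) ℝ}
    (hA : A ∈ Matrix.specialOrthogonalGroup (Fin 3) ℝ) : A.adjugate = Aᵀ := by
  obtain ⟨h1, h2⟩ := Matrix.mem_specialOrthogonalGroup_iff.1 hA
  have h3 : A * Aᵀ = 1 := (Matrix.mem_orthogonalGroup_iff _ _).1 h1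
  calc A.adjugate = A.adjugate * (A * Aᵀ) := by rw [h3, mul_one]
    _ = Aᵀ := by rw [← mul_assoc, Matrix.adjugate_mul, h2, one_smul, one_mul]

/-- A matrix acts on cross products through its cofactor matrix, which for a rotation is the matrix
itself. -/
theorem specialOrthogonal_mulVec_cross {A : Matrix (Fin 3) (Fin 3) ℝ}
    (hA : A ∈ Matrix.specialOrthogonalGroup (Fin 3) ℝ) (x y : Fin 3 → ℝ) :
    (A *ᵥ x) ⨯₃ (A *ᵥ y) = A *ᵥ (x ⨯₃ y) := by
  have h := specialOrthogonal_cofactor hA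
  rw [Matrix.adjugate_fin_three] at h
  have e (i j : Fin 3) := congrFun (congrFun h i) j
  have e00 := e 0 0
  have e01 := e 0 1
  have e02 := e 0 2
  have e10 := e 1 0
  have e11 := e 1 1
  have e12 := e 1 2
  have e20 := e 2 0
  have e21 := e 2 1
  have e22 := e 2 2
  simp [Matrix.transpose_apply] at e00 e01 e02 e10 e11 e12 e20 e21 e22
  ext i
  fin_cases i <;>
    simp [cross_apply, Matrix.mulVec, dotProduct, Fin.sum_univ_three]
  · linear_combination (x 1 * y 2 - x 2 * y 1) * e00 + (x 2 * y 0 - x 0 * y 2) * e10 +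
      (x 0 * y 1 - x 1 * y 0) * e20
  · linear_combination (x 1 * y 2 - x 2 * y 1) * e01 + (x 2 * y 0 - x 0 * y 2) * e11 +
      (x 0 * y 1 - x 1 * y 0) * e21
  · linear_combination (x 1 * y 2 - x 2 * y 1) * e02 + (x 2 * y 0 - x 0 * y 2) * e12 +
      (x 0 * y 1 - x 1 * y 0) * e22

/-- The rows of a moving rotation matrix satisfy `a' = a × Ω`. -/
theorem hasDerivAt_row {R : ℝ → Matrix (Fin 3) (Fin 3) ℝ} {s : ℝ}
    (hd : ∀ i j, DifferentiableAt ℝ (fun r => R r i j) s)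
    (ho : ∀ᶠ r in nhds s, R r ∈ Matrix.specialOrthogonalGroup (Fin 3) ℝ) (i j : Fin 3) :
    HasDerivAt (fun r => R r i j) ((R s i ⨯₃ angularVelocity R s) j) s := by
  have hO : ∀ A ∈ Matrix.specialOrthogonalGroup (Fin 3) ℝ, Aᵀ * A = 1 := fun A hA =>
    (Matrix.mem_orthogonalGroup_iff' _ _).1 (Matrix.mem_specialOrthogonalGroup_iff.1 hA).1
  have hO' : R s * (R s)ᵀ = 1 :=
    (Matrix.mem_orthogonalGroup_iff _ _).1
      (Matrix.mem_specialOrthogonalGroup_iff.1 ho.self_of_nhds).1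
  set A' : Matrix (Fin 3) (Fin 3) ℝ := Matrix.of fun i j => deriv (fun r => R r i j) s with hA'
  set W := (R s)ᵀ * A' with hW
  -- Differentiate `Rᵗ R = 1`. Skewness recovers all of `W` from the three entries that
  -- `angularVelocity` reads.
  have hskew : ∀ j k, W j k + W k j = 0 := by
    intro j k
    have h1 : HasDerivAt (fun r => ((R r)ᵀ * R r) j k) 0 s :=
      (hasDerivAt_const s ((1 : Matrix (Fin 3) (Fin 3) ℝ) j k)).congr_of_eventuallyEq
        (by filter_upwards [ho] with r hr; rw [hO _ hr])
    have h2 := HasDerivAt.fun_sum (u := Finset.univ) fun i _ =>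
      (hd i j).hasDerivAt.mul (hd i k).hasDerivAt
    have h3 := h1.unique h2
    rw [h3, hW]
    simp only [Matrix.mul_apply, Matrix.transpose_apply, ← Finset.sum_add_distrib, hA',
      Matrix.of_apply]
    exact Finset.sum_congr rfl fun _ _ => by ring
  have hAW : A' = R s * W := by rw [hW, ← mul_assoc, hO', one_mul]
  refine (hd i j).hasDerivAt.congr_deriv ?_
  have : deriv (fun r => R r i j) s = A' i j := rfl
  rw [this, hAW]
  have h00 := hskew 0 0
  have h11 := hskew 1 1
  have h22 := hskew 2 2
  have h01 := hskew 0 1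
  have h02 := hskew 0 2
  have h12 := hskew 1 2
  have hΩ : angularVelocity R s = ![W 2 1, W 0 2, W 1 0] := rfl
  rw [hΩ]
  fin_cases j <;> simp [cross_apply, Matrix.mul_apply, Fin.sum_univ_three]
  · linear_combination (R s i 0 / 2) * h00 + R s i 2 * h02
  · linear_combination (R s i 1 / 2) * h11 + R s i 0 * h01
  · linear_combination (R s i 2 / 2) * h22 + R s i 1 * h12

theorem inertia_integrable {B : Type*} [MeasurableSpace B] {μ : Measure B} {Q : B → Fin 3 → ℝ}
    (hQ : MemLp Q 2 μ) (i j : Fin 3) :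
    Integrable (fun b => ((Q b ⬝ᵥ Q b) • (1 : Matrix (Fin 3) (Fin 3) ℝ) -
      Matrix.vecMulVec (Q b) (Q b)) i j) μ := by
  have h (k m : Fin 3) : Integrable (fun b => Q b k * Q b m) μ :=
    (memLp_pi_iff.1 hQ k).integrable_mul (memLp_pi_iff.1 hQ m)
  simp only [Matrix.sub_apply, Matrix.smul_apply, smul_eq_mul, Matrix.vecMulVec_apply,
    dotProduct, Fin.sum_univ_three]
  exact ((((h 0 0).add (h 1 1)).add (h 2 2)).mul_const _).sub (h i j)

theorem inertia_transpose {B : Type*} [MeasurableSpace B] (μ : Measure B) (Q : B → Fin 3 → ℝ) :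
    (inertia μ Q)ᵀ = inertia μ Q := by
  ext i j
  simp only [inertia, Matrix.transpose_apply, Matrix.of_apply, Matrix.sub_apply,
    Matrix.smul_apply, Matrix.vecMulVec_apply, Matrix.one_apply, eq_comm (a := i) (b := j),
    mul_comm (Q _ i)]

/-- Angular momentum of a rigidly rotating body. -/
theorem integral_rigid_momentum {B : Type*} [MeasurableSpace B] {μ : Measure B}
    {Q : B → Fin 3 → ℝ} (hQ : MemLp Q 2 μ) {A : Matrix (Fin 3) (Fin 3) ℝ}
    (hA : A ∈ Matrix.specialOrthogonalGroup (Fin 3) ℝ) (Ω : Fin 3 → ℝ) :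
    ∫ b, (A *ᵥ Q b) ⨯₃ (A *ᵥ (Ω ⨯₃ Q b)) ∂μ = A *ᵥ (inertia μ Q *ᵥ Ω) := by
  -- This is `Q × (Ω × Q) = |Q|² Ω - (Q · Ω) Q`, carried into space by the rotation.
  have hK (b : B) : (A *ᵥ Q b) ⨯₃ (A *ᵥ (Ω ⨯₃ Q b)) =
      A *ᵥ (((Q b ⬝ᵥ Q b) • (1 : Matrix (Fin 3) (Fin 3) ℝ) -
        Matrix.vecMulVec (Q b) (Q b)) *ᵥ Ω) := by
    rw [specialOrthogonal_mulVec_cross hA]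
    congr 1
    ext i
    fin_cases i <;>
      simp [cross_apply, Matrix.mulVec, dotProduct, Fin.sum_univ_three, Matrix.vecMulVec_apply,
        Matrix.one_apply] <;> ring
  simp only [hK]
  have hint (i k : Fin 3) := inertia_integrable hQ i k
  have hi (i j : Fin 3) : Integrable (fun b => A i j * ∑ k, ((Q b ⬝ᵥ Q b) •
      (1 : Matrix (Fin 3) (Fin 3) ℝ) - Matrix.vecMulVec (Q b) (Q b)) j k * Ω k) μ :=
    (integrable_finsetSum _ fun k _ => (hint j k).mul_const _).const_mul _
  ext i
  rw [eval_integral]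
  · simp only [Matrix.mulVec, dotProduct] at hi hint ⊢
    rw [integral_finsetSum _ fun j _ => hi i j]
    refine Finset.sum_congr rfl fun j _ => ?_
    rw [integral_const_mul, integral_finsetSum _ fun k _ => (hint j k).mul_const _]
    simp only [integral_mul_const]
    rfl
  · intro i
    simp only [Matrix.mulVec, dotProduct] at hi ⊢
    exact integrable_finsetSum _ fun j _ => hi i j

/-! ### Kinematics of the dive: rate of rotation about the angular momentum -/

namespace Dive

variable {B : Type*} [MeasurableSpace B] (d : Dive B)

theorem ell_dotProduct_pos : 0 < d.ell ⬝ᵥ d.ell := by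
  have h0 : 0 ≤ d.ell ⬝ᵥ d.ell := Finset.sum_nonneg fun i _ => mul_self_nonneg _
  exact h0.lt_of_ne' fun h => d.ell_ne_zero (dotProduct_self_eq_zero.1 h)

theorem l_pos : 0 < d.l := Real.sqrt_pos.2 d.ell_dotProduct_pos

theorem l_sq : d.l ^ 2 = d.ell ⬝ᵥ d.ell := Real.sq_sqrt d.ell_dotProduct_pos.le

theorem stage_le {i : ℕ} (hi : i < 5) : d.t i ≤ d.t (i + 1) := by
  interval_cases i
  exacts [d.stage_one, d.stage_two.le, d.stage_three, d.stage_four.le, d.stage_five]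

theorem t_le {i j : ℕ} (hij : i ≤ j) (hj : j ≤ 5) : d.t i ≤ d.t j := by
  induction j, hij using Nat.le_induction with
  | base => exact le_rfl
  | succ j _ ih => exact (ih (by omega)).trans (d.stage_le (by omega))

theorem stage_subset {i : ℕ} (hi : i < 5) : Icc (d.t i) (d.t (i + 1)) ⊆ Icc (d.t 0) (d.t 5) :=
  Icc_subset_Icc (d.t_le i.zero_le hi.le) (d.t_le hi le_rfl)

theorem t_zero_mem : d.t 0 ∈ Icc (d.t 0) (d.t 5) := left_mem_Icc.2 (d.t_le (by norm_num) le_rfl)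

theorem t_five_mem : d.t 5 ∈ Icc (d.t 0) (d.t 5) := right_mem_Icc.2 (d.t_le (by norm_num) le_rfl)

theorem succ_mem_stages {i : ℕ} (hi : i < 5) : i + 1 ∈ Icc 1 5 := ⟨by omega, by omega⟩

theorem R_mul_transpose {s : ℝ} (hs : s ∈ Icc (d.t 0) (d.t 5)) : d.R s * (d.R s)ᵀ = 1 :=
  (Matrix.mem_orthogonalGroup_iff _ _).1
    (Matrix.mem_specialOrthogonalGroup_iff.1 (d.R_mem s hs)).1

theorem R_transpose_mul {s : ℝ} (hs : s ∈ Icc (d.t 0) (d.t 5)) : (d.R s)ᵀ * d.R s = 1 :=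
  (Matrix.mem_orthogonalGroup_iff' _ _).1
    (Matrix.mem_specialOrthogonalGroup_iff.1 (d.R_mem s hs)).1

/-- The orientation relative to the initial one. -/
def relR (s : ℝ) : Matrix (Fin 3) (Fin 3) ℝ := (d.R (d.t 0))ᵀ * d.R s

/-- The component of the head-to-toe axis orthogonal to `ell`, as a complex number. -/
def headPhase (s : ℝ) : ℂ := (d.relR s 2 2 : ℂ) + (d.relR s 0 2 : ℂ) * Complex.I

theorem relR_apply (s : ℝ) (i j : Fin 3) :
    d.relR s i j = ∑ k, d.R (d.t 0) k i * d.R s k j := by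
  simp [relR, Matrix.mul_apply]

theorem L_apply (s : ℝ) (j : Fin 3) : d.L s j = ∑ k, d.R s k j * d.ell k := by
  simp [L, Matrix.mulVec, dotProduct]

theorem R_eq {s : ℝ} : d.R s = d.R (d.t 0) * d.relR s := by
  rw [relR, ← mul_assoc, d.R_mul_transpose d.t_zero_mem, one_mul]

theorem relR_mem {s : ℝ} (hs : s ∈ Icc (d.t 0) (d.t 5)) :
    d.relR s ∈ Matrix.specialOrthogonalGroup (Fin 3) ℝ := by
  have h1 := d.R_mem s hs
  have h0 := d.R_mem _ d.t_zero_mem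
  rw [Matrix.mem_specialOrthogonalGroup_iff] at h0
  refine mul_mem (Matrix.mem_specialOrthogonalGroup_iff.2 ⟨?_, ?_⟩) h1
  · rw [Matrix.mem_orthogonalGroup_iff']
    simpa using d.R_mul_transpose d.t_zero_mem
  · rw [Matrix.det_transpose, h0.2]

theorem relR_zero : d.relR (d.t 0) = 1 := d.R_transpose_mul d.t_zero_mem

theorem L_somersault {s : ℝ} (hs : s ∈ Icc (d.t 0) (d.t 1) ∪ Icc (d.t 4) (d.t 5)) :
    d.L s = ![0, d.l, 0] := d.pure_somersault s hs

theorem ell_eq : d.ell = d.R (d.t 0) *ᵥ ![0, d.l, 0] := by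
  rw [← d.L_somersault (Or.inl (left_mem_Icc.2 d.stage_one)), L, Matrix.mulVec_mulVec,
    d.R_mul_transpose d.t_zero_mem, Matrix.one_mulVec]

/-- At the start `ell` points along the body `y`-axis, so in the initial body frame `L / l` is the
middle row of the relative rotation. -/
theorem L_eq (s : ℝ) : d.L s = d.l • d.relR s 1 := by
  ext j
  rw [L_apply, ell_eq]
  simp only [Matrix.mulVec, dotProduct, Fin.sum_univ_three, Pi.smul_apply, relR_apply, smul_eq_mul,
    Matrix.cons_val]
  ring

theorem relR_contDiffOn {i : ℕ} (hi : i < 5) (j k : Fin 3) :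
    ContDiffOn ℝ 1 (fun s => d.relR s j k) (Icc (d.t i) (d.t (i + 1))) := by
  simp only [relR_apply]
  exact ContDiffOn.sum fun m _ =>
    contDiffOn_const.mul (d.R_contDiffOn (i + 1) (succ_mem_stages hi) m k)

theorem L_contDiffOn {i : ℕ} (hi : i < 5) :
    ContDiffOn ℝ 1 d.L (Icc (d.t i) (d.t (i + 1))) := by
  refine contDiffOn_pi.2 fun j => ?_
  simp only [L_apply]
  exact ContDiffOn.sum fun m _ =>
    (d.R_contDiffOn (i + 1) (succ_mem_stages hi) m j).mul contDiffOn_const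

theorem headPhase_contDiffOn {i : ℕ} (hi : i < 5) :
    ContDiffOn ℝ 1 d.headPhase (Icc (d.t i) (d.t (i + 1))) :=
  (Complex.ofRealCLM.contDiff.comp_contDiffOn (d.relR_contDiffOn hi 2 2)).add
    ((Complex.ofRealCLM.contDiff.comp_contDiffOn (d.relR_contDiffOn hi 0 2)).mul
      contDiffOn_const)

theorem R_hasDerivAt {i : ℕ} (hi : i < 5) {s : ℝ} (hs : s ∈ Ioo (d.t i) (d.t (i + 1)))
    (j k : Fin 3) : HasDerivAt (fun r => d.R r j k) ((d.R s j ⨯₃ d.Ω s) k) s := by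
  have hn := Icc_mem_nhds hs.1 hs.2
  refine hasDerivAt_row (fun j k => ?_) ?_ j k
  · exact ((d.R_contDiffOn (i + 1) (succ_mem_stages hi) j k).differentiableOn (by norm_num) s
      (mem_of_mem_nhds hn)).differentiableAt hn
  · filter_upwards [hn] with r hr using d.R_mem r (d.stage_subset hi hr)

theorem relR_hasDerivAt {i : ℕ} (hi : i < 5) {s : ℝ} (hs : s ∈ Ioo (d.t i) (d.t (i + 1)))
    (j k : Fin 3) : HasDerivAt (fun r => d.relR r j k) ((d.relR s j ⨯₃ d.Ω s) k) s := by
  simp only [relR_apply]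
  refine (HasDerivAt.fun_sum fun m _ =>
    (d.R_hasDerivAt hi hs m k).const_mul (d.R (d.t 0) m j)).congr_deriv ?_
  fin_cases k <;> simp [cross_apply, Fin.sum_univ_three, relR_apply] <;> ring

theorem L_hasDerivAt {i : ℕ} (hi : i < 5) {s : ℝ} (hs : s ∈ Ioo (d.t i) (d.t (i + 1))) :
    HasDerivAt d.L (d.L s ⨯₃ d.Ω s) s := by
  refine hasDerivAt_pi.2 fun k => ?_
  simp only [L_apply]
  refine (HasDerivAt.fun_sum fun m _ =>
    (d.R_hasDerivAt hi hs m k).mul_const (d.ell m)).congr_deriv ?_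
  fin_cases k <;> simp [cross_apply, Fin.sum_univ_three, L_apply] <;> ring

theorem headPhase_hasDerivAt {i : ℕ} (hi : i < 5) {s : ℝ} (hs : s ∈ Ioo (d.t i) (d.t (i + 1))) :
    HasDerivAt d.headPhase (((d.relR s 2 ⨯₃ d.Ω s) 2 : ℝ) +
      ((d.relR s 0 ⨯₃ d.Ω s) 2 : ℝ) * Complex.I) s :=
  (d.relR_hasDerivAt hi hs 2 2).ofReal_comp.add
    ((d.relR_hasDerivAt hi hs 0 2).ofReal_comp.mul_const Complex.I)

theorem normSq_headPhase (s : ℝ) :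
    Complex.normSq (d.headPhase s) = d.relR s 2 2 ^ 2 + d.relR s 0 2 ^ 2 := by
  simp [headPhase, Complex.normSq_apply, sq]

/-- Row 1 and column 2 are unit vectors sharing the entry `(1, 2)`. Hence `|headPhase|²` equals
`(L_x² + L_y²) / l²` and vanishes only at the poles. -/
theorem relR_row_col {s : ℝ} (hs : s ∈ Icc (d.t 0) (d.t 5)) :
    d.relR s 2 2 ^ 2 + d.relR s 0 2 ^ 2 = d.relR s 1 0 ^ 2 + d.relR s 1 1 ^ 2 ∧
      d.relR s 1 0 ^ 2 + d.relR s 1 1 ^ 2 + d.relR s 1 2 ^ 2 = 1 := by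
  have h := (Matrix.mem_specialOrthogonalGroup_iff.1 (d.relR_mem hs)).1
  have h1 := congrFun (congrFun ((Matrix.mem_orthogonalGroup_iff _ _).1 h) 1) 1
  have h2 := congrFun (congrFun ((Matrix.mem_orthogonalGroup_iff' _ _).1 h) 2) 2
  simp [Matrix.mul_apply, Fin.sum_univ_three] at h1 h2
  constructor <;> nlinarith

theorem headPhase_ne_zero {s : ℝ} (hs : s ∈ Icc (d.t 0) (d.t 5))
    (h0 : ¬ (d.L s 0 = 0 ∧ d.L s 1 = 0)) : d.headPhase s ≠ 0 := by
  rw [Ne, ← Complex.normSq_eq_zero, normSq_headPhase, (d.relR_row_col hs).1]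
  refine sq_add_sq_ne_zero fun h => h0 ?_
  simp [L_eq, h]

/-- The rate of rotation about `ell`. -/
theorem headPhase_logDeriv_im {i : ℕ} (hi : i < 5) {s : ℝ} (hs : s ∈ Ioo (d.t i) (d.t (i + 1)))
    (h0 : ¬ (d.L s 0 = 0 ∧ d.L s 1 = 0)) :
    d.l * (deriv d.headPhase s / d.headPhase s).im =
      d.L s ⬝ᵥ d.Ω s + azimuthForm (d.L s) (deriv d.L s) := by
  have hs' := d.stage_subset hi (Ioo_subset_Icc_self hs)
  have hl := d.l_pos.ne'
  rw [(d.headPhase_hasDerivAt hi hs).deriv, (d.L_hasDerivAt hi hs).deriv, Complex.div_im,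
    normSq_headPhase, (d.relR_row_col hs').1]
  have h1 := (d.relR_row_col hs').2
  have hcof := specialOrthogonal_cofactor (d.relR_mem hs')
  rw [Matrix.adjugate_fin_three] at hcof
  have e11 := congrFun (congrFun hcof 1) 1
  have e01 := congrFun (congrFun hcof 0) 1
  simp [Matrix.transpose_apply] at e01 e11
  have hq : d.relR s 1 0 ^ 2 + d.relR s 1 1 ^ 2 ≠ 0 :=
    sq_add_sq_ne_zero fun h => h0 (by simp [L_eq, h])
  simp only [L_eq, headPhase, azimuthForm, cross_apply, dotProduct, Fin.sum_univ_three,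
    Pi.smul_apply, smul_eq_mul, Matrix.cons_val, Complex.add_re, Complex.add_im, Complex.mul_re,
    Complex.mul_im, Complex.ofReal_re, Complex.ofReal_im, Complex.I_re, Complex.I_im, map_smul,
    LinearMap.smul_apply, mul_zero, mul_one, sub_zero, zero_add, add_zero]
  -- The 2×2 minors in the numerator are entries of row 1, by the cofactor identities. What remains
  -- after this needs only that row 1 is a unit vector.
  have hN : (d.relR s 0 0 * d.Ω s 1 - d.relR s 0 1 * d.Ω s 0) * d.relR s 2 2 -
      (d.relR s 2 0 * d.Ω s 1 - d.relR s 2 1 * d.Ω s 0) * d.relR s 0 2 =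
      d.relR s 1 0 * d.Ω s 0 + d.relR s 1 1 * d.Ω s 1 := by
    linear_combination d.Ω s 1 * e11 + d.Ω s 0 * e01
  rw [← sub_div, hN]
  have hq2 : (d.l * d.relR s 1 0) ^ 2 + (d.l * d.relR s 1 1) ^ 2 ≠ 0 := by
    rw [mul_pow, mul_pow, ← mul_add]
    exact mul_ne_zero (pow_ne_zero 2 hl) hq
  field_simp
  generalize d.relR s 1 0 = x at *
  generalize d.relR s 1 1 = y at *
  generalize d.relR s 1 2 = z at *
  linear_combination (-(x * d.Ω s 0 + y * d.Ω s 1)) * h1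

/-- The total rotation during a stage. -/
theorem integral_logDeriv_im {i : ℕ} (hi : i < 5)
    (h0 : ∀ s ∈ Icc (d.t 0) (d.t 5), ¬ (d.L s 0 = 0 ∧ d.L s 1 = 0)) :
    d.l * (∫ s in (d.t i)..(d.t (i + 1)), deriv d.headPhase s / d.headPhase s).im =
      (∫ s in (d.t i)..(d.t (i + 1)), d.L s ⬝ᵥ d.Ω s) +
        azimuthIntegral d.L (d.t i) (d.t (i + 1)) := by
  have hle := d.stage_le hi
  have h0' := fun s hs => h0 s (d.stage_subset hi hs)
  have hlog := (hasLogIntegral_of_contDiffOn hle (d.headPhase_contDiffOn hi) fun s hs =>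
    d.headPhase_ne_zero (d.stage_subset hi hs) (h0' s hs)).1
  have haz : IntervalIntegrable (fun s => azimuthForm (d.L s) (deriv d.L s)) volume
      (d.t i) (d.t (i + 1)) := by
    rcases hle.eq_or_lt with h | h
    · simp [h]
    have hd := (d.L_contDiffOn hi).continuousOn_derivWithin (uniqueDiffOn_Icc h) le_rfl
    exact intervalIntegrable_congr_Ioo hle
      (fun s hs => by simp only [eqOn_deriv_derivWithin_Icc d.L _ _ hs])
      (azimuthForm_continuousOn (d.L_contDiffOn hi).continuousOn hd h0')
  have him : IntervalIntegrable (fun s => (deriv d.headPhase s / d.headPhase s).im) volume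
      (d.t i) (d.t (i + 1)) :=
    ⟨Complex.imCLM.integrable_comp hlog.1, Complex.imCLM.integrable_comp hlog.2⟩
  have hE : (∫ s in (d.t i)..(d.t (i + 1)), d.L s ⬝ᵥ d.Ω s) =
      ∫ s in (d.t i)..(d.t (i + 1)), (d.l * (deriv d.headPhase s / d.headPhase s).im -
        azimuthForm (d.L s) (deriv d.L s)) :=
    integral_congr_Ioo hle fun s hs => by
      simp only [d.headPhase_logDeriv_im hi hs (h0' s (Ioo_subset_Icc_self hs))]; ring
  rw [hE, intervalIntegral.integral_sub (him.const_mul _) haz,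
    intervalIntegral.integral_const_mul, azimuthIntegral]
  have := Complex.imCLM.intervalIntegral_comp_comm hlog
  simp only [Complex.imCLM_apply] at this
  rw [this]
  ring

/-! ### Stages of fixed shape: Euler's equations and energy -/

/-- With the shape frozen, a material point moves in space with velocity `R (Ω × Q)`, so the
momentum integral is that of a rigid body. -/
theorem L_eq_inertia_mulVec {i : ℕ} (hi : i < 5) (hi' : i + 1 ∈ ({1, 3, 5} : Set ℕ)) {s : ℝ}
    (hs : s ∈ Ioo (d.t i) (d.t (i + 1))) :
    d.L s = inertia d.mass (d.shape (d.t (i + 1))) *ᵥ d.Ω s := by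
  have hs0 := Ioo_subset_Icc_self hs
  have hs' := d.stage_subset hi hs0
  have hfix := d.shape_fixed (i + 1) hi'
  simp only [Nat.add_sub_cancel] at hfix
  have hm := d.momentum_conserved (i + 1) (succ_mem_stages hi) s hs
  have hder (b : B) : deriv (fun r => d.R r *ᵥ d.shape r b) s =
      d.R s *ᵥ (d.Ω s ⨯₃ d.shape s b) := by
    have he : (fun r => d.R r *ᵥ d.shape r b) =ᶠ[nhds s] fun r => d.R r *ᵥ d.shape s b := by
      filter_upwards [Icc_mem_nhds hs.1 hs.2] with r hr
      rw [hfix r hr, hfix s hs0]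
    rw [he.deriv_eq]
    refine HasDerivAt.deriv (hasDerivAt_pi.2 fun j => ?_)
    simp only [Matrix.mulVec, dotProduct]
    refine (HasDerivAt.fun_sum fun k _ =>
      (d.R_hasDerivAt hi hs j k).mul_const (d.shape s b k)).congr_deriv ?_
    simp [cross_apply, Fin.sum_univ_three]
    ring
  rw [spaceMomentum] at hm
  simp only [hder] at hm
  rw [integral_rigid_momentum (d.shape_memLp s hs') (d.R_mem s hs')] at hm
  rw [L, ← hm, Matrix.mulVec_mulVec, d.R_transpose_mul hs', Matrix.one_mulVec, hfix s hs0]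

theorem Ω_eq {i : ℕ} (hi : i < 5) (hi' : i + 1 ∈ ({1, 3, 5} : Set ℕ)) {s : ℝ}
    (hs : s ∈ Ioo (d.t i) (d.t (i + 1))) :
    d.Ω s = (inertia d.mass (d.shape (d.t (i + 1))))⁻¹ *ᵥ d.L s := by
  have hdet := d.inertia_det_ne_zero (d.t (i + 1))
    (d.stage_subset hi (right_mem_Icc.2 (d.stage_le hi)))
  rw [d.L_eq_inertia_mulVec hi hi' hs, Matrix.mulVec_mulVec,
    Matrix.nonsing_inv_mul _ (isUnit_iff_ne_zero.2 hdet), Matrix.one_mulVec]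

theorem inertia_stage_three : inertia d.mass (d.shape (d.t 3)) = d.It := by
  have := d.shape_fixed 3 (by simp) (d.t 2) (left_mem_Icc.2 d.stage_three)
  rw [It, this]

theorem inertia_stage_one : inertia d.mass (d.shape (d.t 1)) = d.Is := by
  have := d.shape_fixed 1 (by simp) (d.t 0) (left_mem_Icc.2 d.stage_one)
  rw [Is, this]

/-- Work integral of a pure somersault stage. -/
theorem integral_somersault {i : ℕ} (hi : i < 5) (hi' : i + 1 ∈ ({1, 3, 5} : Set ℕ))
    (hI : inertia d.mass (d.shape (d.t (i + 1))) = d.Is)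
    (hL : ∀ s ∈ Ioo (d.t i) (d.t (i + 1)), d.L s = ![0, d.l, 0]) :
    (∫ s in (d.t i)..(d.t (i + 1)), d.L s ⬝ᵥ d.Ω s) = d.τ (i + 1) * (2 * d.Es) ∧
      azimuthIntegral d.L (d.t i) (d.t (i + 1)) = 0 := by
  refine ⟨?_, azimuthIntegral_of_const (d.stage_le hi) hL⟩
  rw [integral_congr_Ioo (d.stage_le hi) (g := fun _ => 2 * d.Es)]
  · simp [τ]
    ring
  · intro s hs
    simp only [d.Ω_eq hi hi' hs, hI, hL s hs, Es, energy]
    ring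

/-- Uniqueness for Euler's equations, which `L` satisfies because `L' = L × Ω` and `Ω = I_t⁻¹ L` in
stage 3. -/
theorem L_eq_orbit {γ : ℝ → Fin 3 → ℝ} (hγ : IsEulerOrbit d.It γ) (hγ0 : γ 0 = d.L (d.t 2))
    {s : ℝ} (hs : s ∈ Icc (d.t 2) (d.t 3)) : d.L s = γ (s - d.t 2) := by
  rcases d.stage_three.eq_or_lt with h | hlt
  · rw [← h] at hs
    rw [le_antisymm hs.2 hs.1, sub_self, hγ0]
  set v : (Fin 3 → ℝ) → Fin 3 → ℝ := fun x => x ⨯₃ (d.It⁻¹ *ᵥ x) with hv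
  have hvC : ContDiff ℝ 1 v := by
    refine contDiff_pi.2 fun i => ?_
    fin_cases i <;> simp only [hv, cross_apply, Matrix.mulVec, dotProduct, Fin.sum_univ_three] <;>
      simp <;> fun_prop
  have hLC := d.L_contDiffOn (i := 2) (by norm_num)
  have hLc := hLC.continuousOn
  have hδ (r : ℝ) : HasDerivAt (fun r => γ (r - d.t 2)) (v (γ (r - d.t 2))) r :=
    (hγ (r - d.t 2)).comp_sub_const r (d.t 2)
  have hδc : Continuous fun r => γ (r - d.t 2) :=
    continuous_iff_continuousAt.2 fun r => (hδ r).continuousAt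
  -- The field is quadratic, hence only locally Lipschitz; a compact set containing both curves
  -- supplies a constant.
  have hK : IsCompact (d.L '' Icc (d.t 2) (d.t 3) ∪
      (fun r => γ (r - d.t 2)) '' Icc (d.t 2) (d.t 3)) :=
    (isCompact_Icc.image_of_continuousOn hLc).union (isCompact_Icc.image hδc)
  obtain ⟨C, hC⟩ := LocallyLipschitzOn.exists_lipschitzOnWith_of_compact hK
    (hvC.locallyLipschitz.locallyLipschitzOn)
  -- The equation is known in the interior. Continuity extends it to the left endpoint, where the
  -- uniqueness theorem needs a right derivative.
  have hEq : EqOn (derivWithin d.L (Icc (d.t 2) (d.t 3))) (fun r => v (d.L r))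
      (Icc (d.t 2) (d.t 3)) := by
    refine EqOn.of_subset_closure (s := Ioo (d.t 2) (d.t 3)) (fun r hr => ?_)
      (hLC.continuousOn_derivWithin (uniqueDiffOn_Icc hlt) le_rfl)
      (hvC.continuous.comp_continuousOn hLc) Ioo_subset_Icc_self (closure_Ioo hlt.ne).ge
    rw [← eqOn_deriv_derivWithin_Icc d.L _ _ hr, (d.L_hasDerivAt (by norm_num) hr).deriv,
      d.Ω_eq (by norm_num) (by simp) hr, d.inertia_stage_three]
  refine ODE_solution_unique_of_mem_Icc_right (v := fun _ => v) (K := C) (fun _ _ => hC) hLc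
    (fun r hr => ?_) (fun r hr => Or.inl ⟨r, Ico_subset_Icc_self hr, rfl⟩) hδc.continuousOn
    (fun r _ => (hδ r).hasDerivWithinAt) (fun r hr => Or.inr ⟨r, Ico_subset_Icc_self hr, rfl⟩)
    (by simp [hγ0]) hs
  rw [show v (d.L r) = _ from (hEq (Ico_subset_Icc_self hr)).symm]
  exact ((hLC.differentiableOn (by norm_num) r
    (Ico_subset_Icc_self hr)).hasDerivWithinAt).mono_of_mem_nhdsWithin (Icc_mem_nhdsGE_of_mem hr)

end Dive

/-- A rigid body conserves its energy. -/
theorem IsEulerOrbit.energy_eq {A : Matrix (Fin 3) (Fin 3) ℝ} {γ : ℝ → Fin 3 → ℝ}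
    (hγ : IsEulerOrbit A γ) (hA : Aᵀ = A) (s : ℝ) : energy A (γ s) = energy A (γ 0) := by
  have hsymm : (A⁻¹)ᵀ = A⁻¹ := by rw [Matrix.transpose_nonsing_inv, hA]
  have e (i j : Fin 3) : A⁻¹ i j = A⁻¹ j i := by
    conv_lhs => rw [← hsymm, Matrix.transpose_apply]
  -- For symmetric `A` the derivative is the triple product of `A⁻¹ γ`, `γ` and `A⁻¹ γ`, which is
  -- zero.
  have hd (r : ℝ) : HasDerivAt (fun r => energy A (γ r)) 0 r := by
    have h := hasDerivAt_pi.1 (hγ r)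
    simp only [energy, Matrix.mulVec, dotProduct]
    refine ((HasDerivAt.fun_sum fun i _ => (h i).mul
      (HasDerivAt.fun_sum fun j _ => (h j).const_mul (A⁻¹ i j))).const_mul (1 / 2)).congr_deriv ?_
    simp only [Fin.sum_univ_three, cross_apply, Matrix.mulVec, dotProduct, Matrix.cons_val,
      e 1 0, e 2 0, e 2 1]
    ring
  exact is_const_of_deriv_eq_zero (fun r => (hd r).differentiableAt) (fun r => (hd r).deriv) s 0

/-! ### The rotation angle: existence, independence of choices, final orientation -/

namespace Dive

variable {B : Type*} [MeasurableSpace B] (d : Dive B)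

theorem inv_l_smul_ell : d.l⁻¹ • d.ell = d.R (d.t 0) *ᵥ ![0, 1, 0] := by
  conv_lhs => rw [ell_eq, ← Matrix.mulVec_smul]
  have := d.l_pos.ne'
  simp [this]

/-- The azimuth of the head-to-toe axis is the argument of `headPhase`. -/
theorem azimuth_iff {s : ℝ} (φ : ℝ) :
    (∃ c r : ℝ, 0 < r ∧ d.R s *ᵥ ![0, 0, 1] = c • d.ell +
      r • (Real.cos φ • (d.R (d.t 0) *ᵥ ![0, 0, 1]) +
        Real.sin φ • ((d.l⁻¹ • d.ell) ⨯₃ (d.R (d.t 0) *ᵥ ![0, 0, 1])))) ↔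
    ∃ r : ℝ, 0 < r ∧ d.relR s 2 2 = r * Real.cos φ ∧ d.relR s 0 2 = r * Real.sin φ := by
  have hl := d.l_pos.ne'
  -- In the initial body frame `ell` is along `e_y`, and `e_y × e_z = e_x`; so the sine goes with
  -- the `x` entry and the cosine with the `z` entry.
  have hrhs (c r : ℝ) : c • d.ell +
      r • (Real.cos φ • (d.R (d.t 0) *ᵥ ![0, 0, 1]) +
        Real.sin φ • ((d.l⁻¹ • d.ell) ⨯₃ (d.R (d.t 0) *ᵥ ![0, 0, 1]))) =
      d.R (d.t 0) *ᵥ ![r * Real.sin φ, c * d.l, r * Real.cos φ] := by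
    rw [inv_l_smul_ell, specialOrthogonal_mulVec_cross (d.R_mem _ d.t_zero_mem)]
    conv_lhs => rw [ell_eq]
    simp only [← Matrix.mulVec_smul, ← Matrix.mulVec_add]
    congr 1
    ext i
    fin_cases i <;> simp [cross_apply]
  have hlhs : d.R s *ᵥ ![0, 0, 1] =
      d.R (d.t 0) *ᵥ ![d.relR s 0 2, d.relR s 1 2, d.relR s 2 2] := by
    conv_lhs => rw [R_eq, ← Matrix.mulVec_mulVec]
    congr 1
    ext i
    fin_cases i <;> simp [Matrix.mulVec, dotProduct, Fin.sum_univ_three]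
  simp only [hrhs, hlhs]
  constructor
  · rintro ⟨c, r, hr, h⟩
    have h' := congrArg (fun x => (d.R (d.t 0))ᵀ *ᵥ x) h
    simp only [Matrix.mulVec_mulVec, d.R_transpose_mul d.t_zero_mem, Matrix.one_mulVec] at h'
    exact ⟨r, hr, by simpa using congrFun h' 2, by simpa using congrFun h' 0⟩
  · rintro ⟨r, hr, h2, h0⟩
    refine ⟨d.relR s 1 2 / d.l, r, hr, ?_⟩
    rw [h2, h0, div_mul_cancel₀ _ hl]

/-- The continuous determination of the angle obtained by integrating the logarithmic derivative. -/
def angle (s : ℝ) : ℝ := (∫ r in (d.t 0)..s, deriv d.headPhase r / d.headPhase r).im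

theorem hasLogIntegral_headPhase
    (h0 : ∀ s ∈ Icc (d.t 0) (d.t 5), ¬ (d.L s 0 = 0 ∧ d.L s 1 = 0)) {s : ℝ}
    (hs : s ∈ Icc (d.t 0) (d.t 5)) : HasLogIntegral d.headPhase (d.t 0) s :=
  hasLogIntegral_of_partition (N := 5) (t := d.t) (fun _ hi => d.stage_le hi)
    (fun _ hi => d.headPhase_contDiffOn hi)
    (fun _ hi s hs => d.headPhase_ne_zero (d.stage_subset hi hs) (h0 s (d.stage_subset hi hs)))
    5 le_rfl s hs

/-- `headPhase` starts at `1`, so it equals the exponential of its logarithmic integral; real and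
imaginary parts of the exponent give modulus and argument. -/
theorem angle_polar (h0 : ∀ s ∈ Icc (d.t 0) (d.t 5), ¬ (d.L s 0 = 0 ∧ d.L s 1 = 0)) {s : ℝ}
    (hs : s ∈ Icc (d.t 0) (d.t 5)) : ∃ r : ℝ, 0 < r ∧
      d.relR s 2 2 = r * Real.cos (d.angle s) ∧ d.relR s 0 2 = r * Real.sin (d.angle s) := by
  have h := (d.hasLogIntegral_headPhase h0 hs).2
  have hw0 : d.headPhase (d.t 0) = 1 := by simp [headPhase, relR_zero]
  rw [hw0, one_mul] at h
  refine ⟨Real.exp (∫ r in (d.t 0)..s, deriv d.headPhase r / d.headPhase r).re,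
    Real.exp_pos _, ?_, ?_⟩
  · have := congrArg Complex.re h
    rw [Complex.exp_re] at this
    rw [angle, ← this]
    simp [headPhase]
  · have := congrArg Complex.im h
    rw [Complex.exp_im] at this
    rw [angle, ← this]
    simp [headPhase]

theorem isRotationAngle_angle
    (h0 : ∀ s ∈ Icc (d.t 0) (d.t 5), ¬ (d.L s 0 = 0 ∧ d.L s 1 = 0)) :
    d.IsRotationAngle d.angle := by
  refine ⟨?_, fun s hs => (d.azimuth_iff _).2 (d.angle_polar h0 hs)⟩
  have := intervalIntegral.continuousOn_primitive_interval'
    (d.hasLogIntegral_headPhase h0 d.t_five_mem).1 left_mem_uIcc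
  rw [uIcc_of_le (d.t_le (by norm_num) le_rfl)] at this
  exact Complex.continuous_im.comp_continuousOn this

theorem cos_sin_eq_of_polar {r r' x y : ℝ} (hr : 0 < r) (hr' : 0 < r')
    (hc : r * Real.cos x = r' * Real.cos y) (hs : r * Real.sin x = r' * Real.sin y) :
    Real.cos x = Real.cos y ∧ Real.sin x = Real.sin y := by
  have h : r ^ 2 = r' ^ 2 := by
    linear_combination (r * Real.cos x + r' * Real.cos y) * hc +
      (r * Real.sin x + r' * Real.sin y) * hs - r ^ 2 * Real.sin_sq_add_cos_sq x +
      r' ^ 2 * Real.sin_sq_add_cos_sq y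
  have h' : r = r' := (pow_left_inj₀ hr.le hr'.le two_ne_zero).1 h
  subst h'
  exact ⟨mul_left_cancel₀ hr.ne' hc, mul_left_cancel₀ hr.ne' hs⟩

theorem IsRotationAngle.sub_eq {d : Dive B} {φ ψ : ℝ → ℝ} (hφ : d.IsRotationAngle φ)
    (hψ : d.IsRotationAngle ψ) : φ (d.t 5) - φ (d.t 0) = ψ (d.t 5) - ψ (d.t 0) := by
  have h : ∀ s ∈ Icc (d.t 0) (d.t 5), Real.cos (φ s) = Real.cos (ψ s) ∧
      Real.sin (φ s) = Real.sin (ψ s) := by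
    intro s hs
    obtain ⟨r, hr, h1, h2⟩ := (d.azimuth_iff _).1 (hφ.2 s hs)
    obtain ⟨r', hr', h1', h2'⟩ := (d.azimuth_iff _).1 (hψ.2 s hs)
    exact cos_sin_eq_of_polar hr hr' (h1.symm.trans h1') (h2.symm.trans h2')
  exact sub_eq_sub_of_cos_sin_eq (d.t_le (by norm_num) le_rfl) hφ.1 hψ.1
    (fun s hs => (h s hs).1) fun s hs => (h s hs).2

/-- As `L` is `(0, l, 0)` at both ends, the relative rotation at `t 5` fixes `e_y`. It is therefore
a rotation about that axis, determined by the image of `e_z`. -/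
theorem IsRotationAngle.rotateAbout_eq {d : Dive B} {φ : ℝ → ℝ} (hφ : d.IsRotationAngle φ)
    (v : Fin 3 → ℝ) : d.R (d.t 5) *ᵥ v =
      rotateAbout (d.l⁻¹ • d.ell) (φ (d.t 5) - φ (d.t 0)) (d.R (d.t 0) *ᵥ v) := by
  have hl := d.l_pos.ne'
  obtain ⟨r, hr, h1, h2⟩ := (d.azimuth_iff _).1 (hφ.2 _ d.t_zero_mem)
  obtain ⟨r', hr', h1', h2'⟩ := (d.azimuth_iff _).1 (hφ.2 _ d.t_five_mem)
  simp only [relR_zero, Matrix.one_apply_eq, Matrix.one_apply_ne (show (0 : Fin 3) ≠ 2 by decide)]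
    at h1 h2
  -- The initial value of `φ` is only a multiple of `2π`, not necessarily `0`.
  obtain ⟨hc0, hs0⟩ := cos_sin_eq_of_polar (y := 0) hr one_pos
    (by rw [← h1]; simp) (by rw [← h2]; simp)
  rw [Real.cos_zero] at hc0
  rw [Real.sin_zero] at hs0
  have hL := d.L_somersault (s := d.t 5) (Or.inr (right_mem_Icc.2 d.stage_five))
  rw [L_eq] at hL
  have e10 : d.relR (d.t 5) 1 0 = 0 := by simpa [hl] using congrFun hL 0
  have e11 : d.relR (d.t 5) 1 1 = 1 := by simpa [hl] using congrFun hL 1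
  have e12 : d.relR (d.t 5) 1 2 = 0 := by simpa [hl] using congrFun hL 2
  have hrow := (d.relR_row_col d.t_five_mem).1
  rw [e10, e11, h1', h2'] at hrow
  have hr1 : r' = 1 := by
    have : r' ^ 2 = 1 ^ 2 := by
      linear_combination hrow - r' ^ 2 * Real.sin_sq_add_cos_sq (φ (d.t 5))
    exact (pow_left_inj₀ hr'.le zero_le_one two_ne_zero).1 this
  rw [hr1, one_mul] at h1' h2'
  have hcof := specialOrthogonal_cofactor (d.relR_mem d.t_five_mem)
  rw [Matrix.adjugate_fin_three] at hcof
  have h00 := congrFun (congrFun hcof 0) 0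
  have h01 := congrFun (congrFun hcof 1) 0
  have h02 := congrFun (congrFun hcof 0) 2
  have h21 := congrFun (congrFun hcof 1) 2
  simp [Matrix.transpose_apply, e10, e11, e12] at h00 h01 h02 h21
  rw [rotateAbout, inv_l_smul_ell, specialOrthogonal_mulVec_cross (d.R_mem _ d.t_zero_mem)]
  have hdot : (d.R (d.t 0) *ᵥ ![0, 1, 0]) ⬝ᵥ (d.R (d.t 0) *ᵥ v) = v 1 := by
    rw [Matrix.dotProduct_mulVec, ← Matrix.mulVec_transpose, Matrix.mulVec_mulVec,
      d.R_transpose_mul d.t_zero_mem, Matrix.one_mulVec]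
    simp [dotProduct, Fin.sum_univ_three]
  rw [hdot]
  conv_lhs => rw [R_eq, ← Matrix.mulVec_mulVec]
  simp only [← Matrix.mulVec_smul, ← Matrix.mulVec_add]
  congr 1
  rw [Real.cos_sub, Real.sin_sub, hc0, hs0]
  ext i
  fin_cases i <;> simp [Matrix.mulVec, dotProduct, Fin.sum_univ_three, cross_apply, Matrix.vecHead,
    Matrix.vecTail, e10, e11, e12, ← h1', ← h2', ← h01, ← h02, ← h21, h00]
  · ring
  · ring

theorem angle_sub (h0 : ∀ s ∈ Icc (d.t 0) (d.t 5), ¬ (d.L s 0 = 0 ∧ d.L s 1 = 0)) :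
    d.l * (d.angle (d.t 5) - d.angle (d.t 0)) =
      ∑ i ∈ Finset.range 5, ((∫ s in (d.t i)..(d.t (i + 1)), d.L s ⬝ᵥ d.Ω s) +
        azimuthIntegral d.L (d.t i) (d.t (i + 1))) := by
  have hint : ∀ i < 5, IntervalIntegrable (fun r => deriv d.headPhase r / d.headPhase r) volume
      (d.t i) (d.t (i + 1)) := fun i hi =>
    (hasLogIntegral_of_contDiffOn (d.stage_le hi) (d.headPhase_contDiffOn hi) fun s hs =>
      d.headPhase_ne_zero (d.stage_subset hi hs) (h0 s (d.stage_subset hi hs))).1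
  have hsum := intervalIntegral.sum_integral_adjacent_intervals hint
  rw [angle, angle, ← hsum, intervalIntegral.integral_same, Complex.zero_im, sub_zero,
    Complex.im_sum, Finset.mul_sum]
  exact Finset.sum_congr rfl fun i hi =>
    d.integral_logDeriv_im (Finset.mem_range.1 hi) h0

end Dive

/-! ### The geometric contribution of the orbit, the band and the triangle -/

/-- Winding along a periodic orbit. -/
theorem azimuthIntegral_periodic {γ : ℝ → Fin 3 → ℝ} {T : ℝ} (hper : Function.Periodic γ T)
    (hγ : ContDiff ℝ 1 γ) (h0 : ∀ s, ¬ (γ s 0 = 0 ∧ γ s 1 = 0)) (n : ℕ) (a : ℝ) :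
    azimuthIntegral γ 0 a + azimuthIntegral γ a (n * T) = n * azimuthIntegral γ 0 T := by
  have hcont : Continuous fun s => azimuthForm (γ s) (deriv γ s) := by
    rw [← continuousOn_univ]
    exact azimuthForm_continuousOn hγ.continuous.continuousOn
      (hγ.continuous_deriv le_rfl).continuousOn fun s _ => h0 s
  have hp : Function.Periodic (fun s => azimuthForm (γ s) (deriv γ s)) T := fun s => by
    have : deriv γ (s + T) = deriv γ s := by
      rw [← deriv_comp_add_const]
      congr 1
      exact funext hper
    simp only [this, hper s]
  -- No order between `a` and `n T` is needed: the integrals are signed.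
  have h := hp.intervalIntegral_add_zsmul_eq n 0 fun _ _ => hcont.intervalIntegrable _ _
  simp only [azimuthIntegral]
  rw [intervalIntegral.integral_add_adjacent_intervals (hcont.intervalIntegrable _ _)
    (hcont.intervalIntegrable _ _)]
  simpa using h

theorem IsEulerOrbit.contDiff {A : Matrix (Fin 3) (Fin 3) ℝ} {γ : ℝ → Fin 3 → ℝ}
    (hγ : IsEulerOrbit A γ) : ContDiff ℝ 1 γ := by
  have hc : Continuous γ := continuous_iff_continuousAt.2 fun s => (hγ s).continuousAt
  rw [contDiff_one_iff_deriv]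
  refine ⟨fun s => (hγ s).differentiableAt, ?_⟩
  rw [funext fun s => (hγ s).deriv]
  refine continuous_pi fun i => ?_
  fin_cases i <;> simp [cross_apply, Matrix.mulVec, dotProduct, Fin.sum_univ_three] <;> fun_prop

/-- In Stokes' theorem the two seams of the band cancel and the equator edge vanishes, leaving the
orbit. -/
theorem IsBandToEquator.azimuthIntegral_eq {l T : ℝ} (hl : 0 < l) {γ : ℝ → Fin 3 → ℝ}
    {F : ℝ → ℝ → Fin 3 → ℝ} (hF : IsBandToEquator l T γ F) :
    azimuthIntegral γ 0 T = -l * solidAngle F := by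
  obtain ⟨hreg, hedge, hper⟩ := hF
  rw [← stokes_azimuthForm hl hreg,
    azimuthIntegral_congr zero_le_one fun v hv => hper v (Ioo_subset_Icc_self hv),
    azimuthIntegral_of_equator (c := fun u => F u 1) zero_le_one
      fun u hu => (hedge u (Ioo_subset_Icc_self hu)).2,
    azimuthIntegral_congr (c := fun u => F u 0) (c' := fun u => γ (0 + T * u)) zero_le_one
      fun u hu => by simp [(hedge u (Ioo_subset_Icc_self hu)).1],
    azimuthIntegral_comp_add_mul]
  simp

/-- The orbit is an edge of the band, and periodicity covers all times. -/
theorem IsBandToEquator.orbit_ne_pole {l T : ℝ} (hT : 0 < T) {γ : ℝ → Fin 3 → ℝ}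
    (hper : Function.Periodic γ T) {F : ℝ → ℝ → Fin 3 → ℝ} (hF : IsBandToEquator l T γ F) (s : ℝ) :
    ¬ (γ s 0 = 0 ∧ γ s 1 = 0) := by
  obtain ⟨r, hr, hrs⟩ := hper.exists_mem_Ico₀ hT s
  have hu : r / T ∈ Icc (0 : ℝ) 1 := ⟨div_nonneg hr.1 hT.le, (div_le_one hT).2 hr.2.le⟩
  have h := (hF.1.2 _ hu 0 (left_mem_Icc.2 zero_le_one)).2
  rwa [(hF.2.1 _ hu).1, mul_div_cancel₀ _ hT.ne', ← hrs] at h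

namespace Dive

variable {B : Type*} [MeasurableSpace B] (d : Dive B)

variable {d} in
-- The collapsed edge contributes nothing. Stage 4 is parametrised backwards and the stage 2 edge
-- enters with a minus sign, so both stages end up on the same side.
theorem IsTriangle.azimuthIntegral_eq {n : ℕ} {T : ℝ} {γ : ℝ → Fin 3 → ℝ}
    {G : ℝ → ℝ → Fin 3 → ℝ} (hG : d.IsTriangle n T γ G) :
    azimuthIntegral d.L (d.t 1) (d.t 2) + azimuthIntegral d.L (d.t 3) (d.t 4) =
      azimuthIntegral γ (d.τ 3) (n * T) + d.l * solidAngle G := by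
  obtain ⟨hreg, hu, hv⟩ := hG
  have h := stokes_azimuthForm d.l_pos hreg
  rw [azimuthIntegral_congr (c := fun u => G u 0) (c' := fun u => d.L (d.t 4 + -d.τ 4 * u))
      zero_le_one fun u hu' => by
        simp only [(hu u (Ioo_subset_Icc_self hu')).1]; congr 1; ring,
    azimuthIntegral_congr (c := fun u => G u 1) (c' := fun u => d.L (d.t 1 + d.τ 2 * u))
      zero_le_one fun u hu' => by
        simp only [(hu u (Ioo_subset_Icc_self hu')).2]; congr 1; ring,
    azimuthIntegral_congr (c := fun v => G 1 v) (c' := fun v => γ (d.τ 3 + (n * T - d.τ 3) * v))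
      zero_le_one fun v hv' => by
        simp only [(hv v (Ioo_subset_Icc_self hv')).2]; congr 1; ring,
    azimuthIntegral_of_const (c := fun v => G 0 v) zero_le_one
      fun v hv' => (hv v (Ioo_subset_Icc_self hv')).1,
    azimuthIntegral_comp_add_mul, azimuthIntegral_comp_add_mul, azimuthIntegral_comp_add_mul] at h
  have e4 : d.t 4 + -d.τ 4 * 1 = d.t 3 := by simp [τ]
  have e2 : d.t 1 + d.τ 2 * 1 = d.t 2 := by simp [τ]
  have e3 : d.τ 3 + (n * T - d.τ 3) * 1 = n * T := by ring
  rw [e4, e2, e3, mul_zero, mul_zero, mul_zero, add_zero, add_zero, add_zero] at h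
  have hrev : azimuthIntegral d.L (d.t 4) (d.t 3) = -azimuthIntegral d.L (d.t 3) (d.t 4) :=
    intervalIntegral.integral_symm _ _
  rw [hrev] at h
  linarith

/-- Stages 1 and 5 rest on the equator, stages 2 and 4 are edges of the triangle, and stage 3
follows the orbit. -/
theorem L_ne_pole {n : ℕ} {T : ℝ} {γ : ℝ → Fin 3 → ℝ} {G : ℝ → ℝ → Fin 3 → ℝ}
    (hG : d.IsTriangle n T γ G) (hL : ∀ s ∈ Icc (d.t 2) (d.t 3), d.L s = γ (s - d.t 2))
    (hγ : ∀ s, ¬ (γ s 0 = 0 ∧ γ s 1 = 0)) {s : ℝ} (hs : s ∈ Icc (d.t 0) (d.t 5)) :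
    ¬ (d.L s 0 = 0 ∧ d.L s 1 = 0) := by
  have hsom : d.L s = ![0, d.l, 0] → ¬ (d.L s 0 = 0 ∧ d.L s 1 = 0) := by
    intro h
    simp [h, d.l_pos.ne']
  rcases le_total s (d.t 1) with h1 | h1
  · exact hsom (d.L_somersault (Or.inl ⟨hs.1, h1⟩))
  rcases le_total (d.t 4) s with h4 | h4
  · exact hsom (d.L_somersault (Or.inr ⟨h4, hs.2⟩))
  obtain ⟨hreg, hu, -⟩ := hG
  rcases le_total s (d.t 2) with h2 | h2
  · have hpos : 0 < d.τ 2 := sub_pos.2 d.stage_two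
    have hmem : (s - d.t 1) / d.τ 2 ∈ Icc (0 : ℝ) 1 :=
      ⟨div_nonneg (by linarith) hpos.le, (div_le_one hpos).2 (by simp [τ]; linarith)⟩
    have h := (hreg.2 _ hmem 1 (right_mem_Icc.2 zero_le_one)).2
    rwa [(hu _ hmem).2, div_mul_cancel₀ _ hpos.ne', add_sub_cancel] at h
  rcases le_total s (d.t 3) with h3 | h3
  · rw [hL s ⟨h2, h3⟩]
    exact hγ _
  · have hpos : 0 < d.τ 4 := sub_pos.2 d.stage_four
    have hmem : (d.t 4 - s) / d.τ 4 ∈ Icc (0 : ℝ) 1 :=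
      ⟨div_nonneg (by linarith) hpos.le, (div_le_one hpos).2 (by simp [τ]; linarith)⟩
    have h := (hreg.2 _ hmem 0 (left_mem_Icc.2 zero_le_one)).2
    rwa [(hu _ hmem).1, div_mul_cancel₀ _ hpos.ne', sub_sub_cancel] at h

theorem integral_twist {γ : ℝ → Fin 3 → ℝ} (hγ : IsEulerOrbit d.It γ) (hγ0 : γ 0 = d.L (d.t 2)) :
    (∫ s in (d.t 2)..(d.t 3), d.L s ⬝ᵥ d.Ω s) = d.τ 3 * (2 * d.Et) ∧
      azimuthIntegral d.L (d.t 2) (d.t 3) = azimuthIntegral γ 0 (d.τ 3) := by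
  constructor
  · rw [integral_congr_Ioo d.stage_three (g := fun _ => 2 * d.Et)]
    · simp [τ]
      ring
    · intro s hs
      have h := hγ.energy_eq (inertia_transpose _ _) (s - d.t 2)
      rw [← d.L_eq_orbit hγ hγ0 (Ioo_subset_Icc_self hs), hγ0] at h
      simp only [d.Ω_eq (i := 2) (by norm_num) (by simp) hs, d.inertia_stage_three]
      rw [Et, ← h, energy]
      ring
  · rw [azimuthIntegral_congr (c' := fun s => γ (-d.t 2 + 1 * s)) d.stage_three fun s hs => by
        rw [d.L_eq_orbit hγ hγ0 (Ioo_subset_Icc_self hs)]; congr 1; ring,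
      azimuthIntegral_comp_add_mul]
    congr 1
    · ring
    · simp [τ]
      ring

theorem two_mul_Ebar {i : ℕ} (h : d.τ i ≠ 0) :
    2 * d.Ebar i * d.τ i = ∫ s in (d.t (i - 1))..(d.t i), d.L s ⬝ᵥ d.Ω s := by
  rw [Ebar]
  field_simp

end Dive

end Somersault
end

/-! ### Assembling the dynamic and geometric contributions -/

theorem mainTheorem2 {B : Type*} [MeasurableSpace B] (d : Somersault.Dive B)
    (n : ℕ) (T : ℝ) (γ : ℝ → Fin 3 → ℝ)
    (hγ : Somersault.IsEulerOrbit d.It γ) (hγ0 : γ 0 = d.L (d.t 2))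
    (hT : Somersault.IsLeastPeriod γ T)
    (F : ℝ → ℝ → Fin 3 → ℝ) (hF : Somersault.IsBandToEquator d.l T γ F)
    (G : ℝ → ℝ → Fin 3 → ℝ) (hG : d.IsTriangle n T γ G) :
    (∃ φ : ℝ → ℝ, d.IsRotationAngle φ) ∧
    ∀ φ : ℝ → ℝ, d.IsRotationAngle φ →
      (∀ v : Fin 3 → ℝ, d.R (d.t 5) *ᵥ v =
        Somersault.rotateAbout (d.l⁻¹ • d.ell) (φ (d.t 5) - φ (d.t 0)) (d.R (d.t 0) *ᵥ v)) ∧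
      φ (d.t 5) - φ (d.t 0) =
        d.kickRotation n (Somersault.solidAngle F)
          + 2 * d.Ebar 2 * d.τ 2 / d.l + 2 * d.Ebar 4 * d.τ 4 / d.l
          + Somersault.solidAngle G := by
  have hl := d.l_pos.ne'
  have hpole := hF.orbit_ne_pole hT.1 hT.2.1
  have h0 : ∀ s ∈ Icc (d.t 0) (d.t 5), ¬ (d.L s 0 = 0 ∧ d.L s 1 = 0) := fun s hs =>
    d.L_ne_pole hG (fun r hr => d.L_eq_orbit hγ hγ0 hr) hpole hs
  have hangle := d.isRotationAngle_angle h0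
  refine ⟨⟨_, hangle⟩, fun φ hφ => ⟨hφ.rotateAbout_eq, ?_⟩⟩
  rw [hφ.sub_eq hangle]
  have hsum := d.angle_sub h0
  obtain ⟨h1, h1'⟩ := d.integral_somersault (i := 0) (by norm_num) (by simp) d.inertia_stage_one
    fun s hs => d.L_somersault (Or.inl (Ioo_subset_Icc_self hs))
  obtain ⟨h5, h5'⟩ := d.integral_somersault (i := 4) (by norm_num) (by simp) d.inertia_eq
    fun s hs => d.L_somersault (Or.inr (Ioo_subset_Icc_self hs))
  obtain ⟨h3, h3'⟩ := d.integral_twist hγ hγ0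
  have h2 := d.two_mul_Ebar (i := 2) (sub_pos.2 d.stage_two).ne'
  have h4 := d.two_mul_Ebar (i := 4) (sub_pos.2 d.stage_four).ne'
  have htri := hG.azimuthIntegral_eq
  -- Stage 3 covers the orbit from `0` to `τ₃` and the triangle's side covers `τ₃` to `n T`:
  -- together `n` periods, each worth `-l S`.
  have hper := Somersault.azimuthIntegral_periodic hT.2.1 hγ.contDiff hpole n (d.τ 3)
  rw [hF.azimuthIntegral_eq d.l_pos] at hper
  simp only [Finset.sum_range_succ, Finset.sum_range_zero, Nat.reduceAdd, Nat.reduceSub, zero_add]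
    at hsum h1 h1' h5 h5' h2 h4
  rw [h1, h1', h3, h3', h5, h5', ← h2, ← h4] at hsum
  rw [Somersault.Dive.kickRotation]
  field_simp
  linarith
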